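/- All logarithms are to base two. Let $\rho_v=\tfrac12(|v_1\rangle\langle v_1|+|v_2\rangle\langle v_2|)$ be the rank-two state on $\mathbb C^3\otimes\mathbb C^3$ (systems $A$, $B$) with $|v_1\rangle=\tfrac1{\sqrt2}(|01\rangle-|10\rangle)$ and $|v_2\rangle=\tfrac1{\sqrt2}(|02\rangle-|20\rangle)$, and let $T_B$ denote partial transposition on Bob's side. An operator $E$ is PPT if $E\ge0$ and $E^{T_B}\ge 0$. A PPT operation is a completely positive trace-preserving map $\Lambda$ from operators on $A\otimes B$ to operators on $A'\otimes B'$ whose Choi–Jamiołkowski matrix is PPT with respect to the bipartition $AA':BB'$. Let $\Phi(d)=\frac1d\sum_{i,j=1}^d|ii\rangle\langle jj|$. Tensor powers $\rho^{\otimes n}$ are regarded as bipartite between all of Alice's and all of Bob's systems. For a bipartite state $\rho$ put $$E_{D,PPT}(\rho)=\sup\Big\{r\ge0:\ \lim_{n\to\infty}\inf_{\Lambda}\big\|\Lambda(\rho^{\otimes n})-\Phi(\lfloor2^{rn}\rfloor)\big\|_1=0\Big\},$$ $$E_{C,PPT}(\rho)=\inf\Big\{r\ge0:\ \lim_{n\to\infty}\inf_{\Lambda}\big\|\rho^{\otimes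 n}-\Lambda(\Phi(\lfloor2^{rn}\rfloor))\big\|_1=0\Big\},$$ where $\Lambda$ ranges over all PPT operations between the respective systems. With $S(\rho\|\sigma)=\operatorname{tr}(\rho\log\rho-\rho\log\sigma)$ (equal to $+\infty$ unless $\operatorname{supp}\rho\subseteq\operatorname{supp}\sigma$), put $$R(\rho)=\inf\{S(\rho\|\sigma):\ \sigma\ge0,\ \operatorname{tr}|\sigma^{T_B}|\le1\},\qquad E_{R,PPT}(\rho)=\inf\{S(\rho\|\sigma):\ \sigma,\sigma^{T_B}\ge0,\ \operatorname{tr}\sigma=1\},$$ $$R^\infty(\rho)=\lim_{n\to\infty}\tfrac1nR(\rho^{\otimes n}),\qquad E^\infty_{R,PPT}(\rho)=\lim_{n\to\infty}\tfrac1nE_{R,PPT}(\rho^{\otimes n}).$$ **Theorem.** For $\rho=\rho_v$ both limits exist, and $$E_{C,PPT}(\rho_v)=E^\infty_{R,PPT}(\rho_v)>R^\infty(\rho_v)=E_{D,PPT}(\rho_v).$$ Moreover $E_{C,PPT}(\rho_v)=E^\infty_{R,PPT}(\rho_v)=1$ and $R^\infty(\rho_v)=E_{D,PPT}(\rho_v)=\log\big(1+\tfrac1{\sqrt2}\big)<1$.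 So entanglement manipulation under PPT operations is asymptotically irreversible for $\rho_v$, and the regularized Rains bound differs from $E^\infty_{R,PPT}$. -/

import Mathlib

open Filter Topology
open scoped ComplexOrder Kronecker ENNReal

namespace PPTEnt

noncomputable section

variable {α β α' β' : Type*}
  [Fintype α] [DecidableEq α] [Fintype β] [DecidableEq β]
  [Fintype α'] [DecidableEq α'] [Fintype β'] [DecidableEq β']

/-- Complex square matrices indexed by `ι`, i.e. linear operators on `ℂ^ι`. A bipartite operator
(Alice `ℂ^α`, Bob `ℂ^β`) is an element of `Op (α × β)`. -/
abbrev Op (ι : Type*) := Matrix ι ι ℂ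

/-- Partial transpose over the second system `B`. -/
def partialTranspose (X : Op (α × β)) : Op (α × β) :=
  Matrix.of fun x y => X (x.1, y.2) (y.1, x.2)

/-- A PPT operator: positive semidefinite with positive semidefinite partial transpose. -/
def IsPPT (X : Op (α × β)) : Prop :=
  X.PosSemidef ∧ (partialTranspose X).PosSemidef

/-- `|R| = √(R† R)`. -/
def absOp (R : Op α) : Op α := cfc Real.sqrt (R.conjTranspose * R)

/-- The trace norm `‖R‖₁ = tr |R|`. -/
def traceNorm (R : Op α) : ℝ := (absOp R).trace.re

/-- The base-two operator logarithm of a Hermitian matrix, with the convention `log 0 = 0` on the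
kernel. -/
def log2Op (X : Op α) : Op α := cfc (Real.logb 2) X

open Classical in
/-- Quantum relative entropy `S(ρ‖σ) = tr (ρ log ρ - ρ log σ)` (base two) of positive
semidefinite operators; it is `+∞` unless `ker σ ⊆ ker ρ`, i.e. `supp ρ ⊆ supp σ`. -/
def relEntropy (ρ σ : Op α) : EReal :=
  if ∀ v : α → ℂ, σ.mulVec v = 0 → ρ.mulVec v = 0 then
    (((ρ * log2Op ρ - ρ * log2Op σ).trace.re : ℝ) : EReal)
  else ⊤

/-- Rains' bound. -/
def rainsBound (ρ : Op (α × β)) : EReal :=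
  ⨅ σ ∈ {σ : Op (α × β) | σ.PosSemidef ∧ traceNorm (partialTranspose σ) ≤ 1}, relEntropy ρ σ

/-- Relative entropy of entanglement with respect to the PPT states. -/
def reePPT (ρ : Op (α × β)) : EReal :=
  ⨅ σ ∈ {σ : Op (α × β) | IsPPT σ ∧ σ.trace = 1}, relEntropy ρ σ

/-- The `n`-fold tensor power `ρ^{⊗n}`, as a bipartite operator with all of Alice's systems on one
side and all of Bob's systems on the other. -/
def tensorPower (ρ : Op (α × β)) (n : ℕ) : Op ((Fin n → α) × (Fin n → β)) :=
  Matrix.of fun x y => ∏ i, ρ (x.1 i, x.2 i) (y.1 i, y.2 i)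

/-- The `d ⊗ d` maximally entangled state `Φ(d) = (1/d) ∑_{i,j} |ii⟩⟨jj|`. -/
def maxEntangled (d : ℕ) : Op (Fin d × Fin d) :=
  (1 / (d : ℂ)) • ∑ i : Fin d, ∑ j : Fin d, Matrix.single (i, i) (j, j) (1 : ℂ)

/-- The map `id_k ⊗ N`. -/
def ampliation (k : ℕ) (N : Op α →ₗ[ℂ] Op β) (X : Op (Fin k × α)) : Op (Fin k × β) :=
  Matrix.of fun x y => N (Matrix.of fun p q => X (x.1, p) (y.1, q)) x.2 y.2

/-- Complete positivity: every `id_k ⊗ N` preserves positive semidefiniteness. -/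
def IsCompletelyPositive (N : Op α →ₗ[ℂ] Op β) : Prop :=
  ∀ (k : ℕ) (X : Op (Fin k × α)), X.PosSemidef → (ampliation k N X).PosSemidef

/-- A quantum channel: a completely positive trace-preserving linear map. -/
def IsChannel (N : Op α →ₗ[ℂ] Op β) : Prop :=
  IsCompletelyPositive N ∧ ∀ X, (N X).trace = X.trace

/-- The Choi–Jamiołkowski matrix `∑_{i,j} |i⟩⟨j| ⊗ N(|i⟩⟨j|)`. -/
def choi (N : Op α →ₗ[ℂ] Op β) : Op (α × β) :=
  ∑ i, ∑ j, Matrix.single i j (1 : ℂ) ⊗ₖ N (Matrix.single i j 1)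

/-- The Choi–Jamiołkowski matrix of a bipartite map from `A ⊗ B` to `A' ⊗ B'`, reordered as a
bipartite operator for the cut `A A' : B B'`. -/
def bipartiteChoi (Λ : Op (α × β) →ₗ[ℂ] Op (α' × β')) : Op ((α × α') × (β × β')) :=
  (choi Λ).submatrix (Equiv.prodProdProdComm α α' β β') (Equiv.prodProdProdComm α α' β β')

/-- A PPT operation: a bipartite quantum channel whose Choi–Jamiołkowski matrix is PPT. -/
def IsPPTOperation (Λ : Op (α × β) →ₗ[ℂ] Op (α' × β')) : Prop :=
  IsChannel Λ ∧ IsPPT (bipartiteChoi Λ)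

/-- `inf_Λ ‖Λ(ρ) - τ‖₁` over all PPT operations `Λ`. -/
def conversionError (ρ : Op (α × β)) (τ : Op (α' × β')) : ℝ≥0∞ :=
  ⨅ Λ ∈ {Λ : Op (α × β) →ₗ[ℂ] Op (α' × β') | IsPPTOperation Λ},
    ENNReal.ofReal (traceNorm (Λ ρ - τ))

/-- PPT distillable entanglement: the supremum of the rates `r ≥ 0` at which `Φ(⌊2^{rn}⌋)` can be
obtained from `ρ^{⊗n}` by PPT operations with asymptotically vanishing error. -/
def distillablePPT (ρ : Op (α × β)) : EReal :=
  sSup ((fun r : ℝ => (r : EReal)) '' {r : ℝ | 0 ≤ r ∧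
    Tendsto (fun n : ℕ => conversionError (tensorPower ρ n) (maxEntangled ⌊(2 : ℝ) ^ (r * n)⌋₊))
      atTop (𝓝 0)})

/-- PPT entanglement cost: the infimum of the rates `r ≥ 0` at which `Φ(⌊2^{rn}⌋)` can be converted
to `ρ^{⊗n}` by PPT operations with asymptotically vanishing error. -/
def costPPT (ρ : Op (α × β)) : EReal :=
  sInf ((fun r : ℝ => (r : EReal)) '' {r : ℝ | 0 ≤ r ∧
    Tendsto (fun n : ℕ => conversionError (maxEntangled ⌊(2 : ℝ) ^ (r * n)⌋₊) (tensorPower ρ n))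
      atTop (𝓝 0)})

/-- `L` is the regularized Rains' bound `lim (1/n) R(ρ^{⊗n})` (and the limit exists). -/
def IsRegularizedRains (ρ : Op (α × β)) (L : EReal) : Prop :=
  Tendsto (fun n : ℕ => ((1 / (n : ℝ) : ℝ) : EReal) * rainsBound (tensorPower ρ n)) atTop (𝓝 L)

/-- `L` is the regularized PPT relative entropy of entanglement `lim (1/n) E_R(ρ^{⊗n})`
(and the limit exists). -/
def IsRegularizedREE (ρ : Op (α × β)) (L : EReal) : Prop :=
  Tendsto (fun n : ℕ => ((1 / (n : ℝ) : ℝ) : EReal) * reePPT (tensorPower ρ n)) atTop (𝓝 L)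

/-- The computational basis vector `|ij⟩` of `ℂ³ ⊗ ℂ³`. -/
def ket (i j : Fin 3) : Fin 3 × Fin 3 → ℂ := Pi.single (i, j) 1

/-- `|v₁⟩ = (|01⟩ - |10⟩)/√2`. -/
def v1 : Fin 3 × Fin 3 → ℂ := ((1 / √2 : ℝ) : ℂ) • (ket 0 1 - ket 1 0)

/-- `|v₂⟩ = (|02⟩ - |20⟩)/√2`. -/
def v2 : Fin 3 × Fin 3 → ℂ := ((1 / √2 : ℝ) : ℂ) • (ket 0 2 - ket 2 0)

/-- The rank-one operator `|v⟩⟨v|`. -/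
def proj (v : α → ℂ) : Op α := Matrix.vecMulVec v (star v)

/-- The state `ρ_v = ½ (|v₁⟩⟨v₁| + |v₂⟩⟨v₂|)`. -/
def rhoV : Op (Fin 3 × Fin 3) := (1 / 2 : ℂ) • (proj v1 + proj v2)

end

end PPTEnt

/-!
All four quantities are computed exactly from a handful of `9 × 9` operators on `ℂ³ ⊗ ℂ³`.

Let `Π` (`suppOp`) be the projection onto the span of `|0k⟩, |k0⟩`, `k = 1, 2`, let `S` (`swapOp`)
be the flip on that span, and `Z = S^Γ` (`crossOp`), where `Γ` is the partial transpose. Then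
`ρ = (Π - S) / 4` is half of the projection `P = (Π - S) / 2`, and everything follows from
`Π² = S² = Π`, `Π S = S Π = S`, `Π Z = Z Π = 0`, `Z³ = 2 Z`. The certificates below are stable under
tensor powers, so each of them settles all `n` at once.

* **Cost and relative entropy of entanglement.** Let `U` (`involOp`) be the symmetric involution
  fixing `|0j⟩, |j0⟩` and flipping `|kl⟩ ↔ |lk⟩` for `k, l ≥ 1`. Then `-U^Γ ≤ 2 P^Γ ≤ U^Γ`, so
  `tr P^{⊗n} ω = tr (P^Γ)^{⊗n} ω^Γ ≤ 2^{-n} tr U^{⊗n} ω ≤ 2^{-n} tr ω` for every PPT operator `ω`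
  (`re_trace_support_mul_le`). As `ρ^{⊗n}` is a normalized projection, Jensen's inequality gives
  `S(ρ^{⊗n}‖σ) ≥ -log tr P^{⊗n} σ` (`neg_logb_le_relEntropy`), hence `E_R(ρ^{⊗n}) ≥ n`, and
  `σ = (Π / 4)^{⊗n}` attains it. The same overlap bound together with
  `Φ(d) ≤ ∑ᵢ |ii⟩⟨ii|` shows that the image of `Φ(d)` under a PPT operation has overlap at most
  `2^{-n} d` with `P^{⊗n}`, so rates below `1` are impossible; conversely `ρ` is a mixture of two
  states locally isometric to `Φ(2)`, so rate `1` is achieved without error.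

* **Rains' bound and distillation.** Put `c = 2 - √2 = 1 / (1 + 1 / √2)`. The test
  `F = c Π - (√2 - 1) S` (`testOp`) satisfies `P ≤ F ≤ 1` and `F^Γ = c V` with `V³ = V`. Hence
  `tr P^{⊗n} σ ≤ tr F^{⊗n} σ ≤ c^n ‖σ^Γ‖₁`, so `R(ρ^{⊗n}) ≥ n log (1 / c)`; since
  `‖ρ^Γ‖₁ = 1 / c`, the choice `σ = (c ρ)^{⊗n}` attains it. Measuring `F^{⊗n}` and preparing `Φ(d)`
  is a PPT operation as soon as `d c^n ≤ 1`, and it accepts `ρ^{⊗n}` with certainty, so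
  `log (1 / c)` is an achievable distillation rate. It is optimal because the fidelity with `Φ(d)`
  reached from `ρ^{⊗n}` is at most `‖(ρ^Γ)^{⊗n}‖₁ / d = c^{-n} / d`
  (`re_trace_maxEntangled_mul_le`).
-/

namespace PPTEnt

/-! ### Positive semidefinite operators and trace inequalities -/

section TraceInequalities

variable {ι : Type*} [Fintype ι] [DecidableEq ι]

open scoped MatrixOrder in
theorem exists_eq_conjTranspose_mul_self {A : Op ι} (hA : A.PosSemidef) :
    ∃ B : Op ι, A = B.conjTranspose * B :=
  CStarAlgebra.nonneg_iff_eq_star_mul_self.mp hA.nonneg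

theorem re_trace_mul_nonneg {A B : Op ι} (hA : A.PosSemidef) (hB : B.PosSemidef) :
    0 ≤ (A * B).trace.re := by
  obtain ⟨C, rfl⟩ := exists_eq_conjTranspose_mul_self hA
  rw [Matrix.mul_assoc, Matrix.trace_mul_comm]
  exact (Complex.le_def.1 (hB.mul_mul_conjTranspose_same C).trace_nonneg).1

/-- The trace-norm/operator-norm Hölder inequality: `-Y ≤ X ≤ Y` says that `tr Y` dominates
`‖X‖₁`, and `-t ≤ G ≤ t` that `‖G‖ ≤ t`. -/
theorem re_trace_mul_le_of_bounds {G X Y : Op ι} {t : ℝ}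
    (h1 : ((t : ℂ) • 1 - G).PosSemidef) (h2 : ((t : ℂ) • 1 + G).PosSemidef)
    (h3 : (Y - X).PosSemidef) (h4 : (Y + X).PosSemidef) :
    (G * X).trace.re ≤ t * Y.trace.re := by
  have e1 := re_trace_mul_nonneg h1 h4
  have e2 := re_trace_mul_nonneg h2 h3
  simp only [sub_mul, add_mul, mul_sub, mul_add, Matrix.smul_mul, one_mul, Matrix.trace_add,
    Matrix.trace_sub, Matrix.trace_smul, Complex.add_re, Complex.sub_re, smul_eq_mul,
    Complex.re_ofReal_mul] at e1 e2
  linarith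

theorem re_trace_mul_mono_left {A B C : Op ι} (h : (B - A).PosSemidef) (hC : C.PosSemidef) :
    (A * C).trace.re ≤ (B * C).trace.re := by
  have := re_trace_mul_nonneg h hC
  rw [sub_mul, Matrix.trace_sub, Complex.sub_re] at this
  linarith

omit [DecidableEq ι] in
theorem posSemidef_of_idempotent {A : Op ι} (hA : A.IsHermitian) (h : A * A = A) :
    A.PosSemidef := by
  have := Matrix.posSemidef_conjTranspose_mul_self A
  rwa [hA.eq, h] at this

/-- A Hermitian `V` with `V³ = V` has spectrum in `{-1, 0, 1}`. The certificate is
`1 - V = (1 - V²) + ½ (V² - V)²`, with `1 - V²` a projection. -/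
theorem one_sub_posSemidef_of_cube {V : Op ι} (hV : V.IsHermitian) (h : V * V * V = V) :
    (1 - V).PosSemidef := by
  have hVV : (V * V).IsHermitian := by
    have := Matrix.isHermitian_conjTranspose_mul_self V
    rwa [hV.eq] at this
  have h4 : V * V * (V * V) = V * V := by rw [← mul_assoc, h]
  have a1 : (1 - V * V).PosSemidef := by
    refine posSemidef_of_idempotent (Matrix.isHermitian_one.sub hVV) ?_
    rw [mul_sub, sub_mul, sub_mul, h4]; simp
  have a2 : ((1 / 2 : ℂ) • ((V * V - V) * (V * V - V))).PosSemidef := by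
    refine Matrix.PosSemidef.smul ?_ (by norm_num [Complex.le_def])
    have := Matrix.posSemidef_conjTranspose_mul_self (V * V - V)
    rwa [(hVV.sub hV).eq] at this
  have : 1 - V = (1 - V * V) + (1 / 2 : ℂ) • ((V * V - V) * (V * V - V)) := by
    rw [mul_sub, sub_mul, sub_mul, h4, ← mul_assoc, h]
    ext i j
    simp
    ring
  rw [this]
  exact a1.add a2

theorem one_add_posSemidef_of_cube {V : Op ι} (hV : V.IsHermitian) (h : V * V * V = V) :
    (1 + V).PosSemidef := by
  have := one_sub_posSemidef_of_cube (V := -V) hV.neg (by simp [h])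
  simpa using this

end TraceInequalities

/-! ### Trace norm, operator logarithm and relative entropy -/

section SpectralFunctions

variable {ι : Type*} [Fintype ι] [DecidableEq ι]

theorem cfc_self {X : Op ι} (hX : X.IsHermitian) : cfc (fun x : ℝ => x) X = X := cfc_id' ℝ X hX

theorem cfc_mul_self {X : Op ι} (hX : X.IsHermitian) (f : ℝ → ℝ) :
    cfc f (X * X) = cfc (fun x : ℝ => f (x ^ 2)) X := by
  have hc : ContinuousOn f ((fun x : ℝ => x ^ 2) '' spectrum ℝ X) :=
    (X.finite_real_spectrum.image _).continuousOn f
  have := cfc_comp_pow f 2 X hc hX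
  rw [← pow_two]
  exact this.symm

theorem absOp_eq_of_sq {X Y : Op ι} (hY : Y.PosSemidef) (h : Y * Y = X.conjTranspose * X) :
    absOp X = Y := by
  rw [absOp, ← h, cfc_mul_self hY.isHermitian]
  conv_rhs => rw [← cfc_self hY.isHermitian]
  refine cfc_congr fun x hx => ?_
  rw [hY.isHermitian.spectrum_real_eq_range_eigenvalues] at hx
  obtain ⟨i, rfl⟩ := hx
  exact Real.sqrt_sq (hY.eigenvalues_nonneg i)

theorem traceNorm_zero : traceNorm (0 : Op ι) = 0 := by
  rw [traceNorm, absOp_eq_of_sq Matrix.PosSemidef.zero (by simp)]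
  simp

theorem absOp_eq_cfc_abs {X : Op ι} (hX : X.IsHermitian) :
    absOp X = cfc (fun x : ℝ => |x|) X := by
  rw [absOp, hX.eq, cfc_mul_self hX]
  exact cfc_congr fun x _ => Real.sqrt_sq_eq_abs x

open scoped MatrixOrder in
theorem absOp_sub_posSemidef {X : Op ι} (hX : X.IsHermitian) : (absOp X - X).PosSemidef := by
  have h := (cfc_self hX).symm
  rw [← Matrix.le_iff, absOp_eq_cfc_abs hX]
  conv_lhs => rw [h]
  exact cfc_mono fun x _ => le_abs_self x

open scoped MatrixOrder in
theorem absOp_add_posSemidef {X : Op ι} (hX : X.IsHermitian) : (absOp X + X).PosSemidef := by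
  have h : -X = cfc (fun x : ℝ => -x) X := by
    have := cfc_neg (fun x : ℝ => x) X
    conv_lhs => rw [← cfc_self hX]
    exact this.symm
  rw [← sub_neg_eq_add, ← Matrix.le_iff, absOp_eq_cfc_abs hX, h]
  exact cfc_mono fun x _ => neg_le_abs x

/-- If `-t ≤ G ≤ t` then `tr G X ≤ t ‖X‖₁`. -/
theorem re_trace_mul_le_traceNorm {G X : Op ι} {t : ℝ}
    (h1 : ((t : ℂ) • 1 - G).PosSemidef) (h2 : ((t : ℂ) • 1 + G).PosSemidef)
    (hX : X.IsHermitian) : (G * X).trace.re ≤ t * traceNorm X :=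
  re_trace_mul_le_of_bounds h1 h2 (absOp_sub_posSemidef hX) (absOp_add_posSemidef hX)

theorem eigenvalues_of_sq {A : Op ι} (hA : A.IsHermitian) {p : ℝ}
    (h : A * A = (p : ℂ) • A) (i : ι) : hA.eigenvalues i = 0 ∨ hA.eigenvalues i = p := by
  have h1 := hA.mulVec_eigenvectorBasis i
  set v : ι → ℂ := ⇑(hA.eigenvectorBasis i) with hv
  have hne : v ≠ 0 := by
    intro h0
    apply hA.eigenvectorBasis.toBasis.ne_zero i
    ext j
    simpa using congrFun h0 j
  have h2 : (A * A).mulVec v = ((p : ℂ) • A).mulVec v := by rw [h]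
  rw [← Matrix.mulVec_mulVec, Matrix.smul_mulVec, h1, Matrix.mulVec_smul, h1] at h2
  obtain ⟨j, hj⟩ := Function.ne_iff.1 hne
  have h3 := congrFun h2 j
  simp only [Pi.smul_apply, Complex.real_smul, smul_eq_mul] at h3
  have h4 : ((hA.eigenvalues i * (hA.eigenvalues i - p) : ℝ) : ℂ) * v j = 0 := by
    push_cast; linear_combination h3
  rcases mul_eq_zero.1 h4 with h5 | h5
  · rcases mul_eq_zero.1 (Complex.ofReal_eq_zero.1 h5) with h6 | h6
    · exact Or.inl h6
    · exact Or.inr (sub_eq_zero.1 h6)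
  · exact absurd h5 hj

/-- The logarithm of a multiple `A = p P` of a projection `P` is `(log p) P`. -/
theorem log2Op_of_sq {A : Op ι} (hA : A.IsHermitian) {p : ℝ} (hp : p ≠ 0)
    (h : A * A = (p : ℂ) • A) : log2Op A = ((Real.logb 2 p / p : ℝ) : ℂ) • A := by
  have : log2Op A = cfc (fun x : ℝ => (Real.logb 2 p / p) * x) A := by
    refine cfc_congr fun x hx => ?_
    rw [hA.spectrum_real_eq_range_eigenvalues] at hx
    obtain ⟨i, rfl⟩ := hx
    rcases eigenvalues_of_sq hA h i with h0 | h0 <;> simp only [h0]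
    · simp
    · field_simp
  refine (this.trans (cfc_const_mul_id (Real.logb 2 p / p) A hA)).trans ?_
  ext i j
  simp

theorem trace_mul_cfc {σ : Op ι} (hσ : σ.IsHermitian) (ρ : Op ι) (f : ℝ → ℝ) :
    (ρ * cfc f σ).trace = ∑ i, (star (hσ.eigenvectorUnitary : Op ι) * ρ *
      (hσ.eigenvectorUnitary : Op ι)) i i * (f (hσ.eigenvalues i) : ℂ) := by
  rw [hσ.cfc_eq, Matrix.IsHermitian.cfc, Unitary.conjStarAlgAut_apply, ← mul_assoc,
    Matrix.trace_mul_comm, ← mul_assoc, ← mul_assoc, Matrix.trace]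
  simp [Matrix.mul_diagonal]

/-- Jensen's inequality for the logarithm, `tr ρ log σ ≤ log tr ρσ`, in the tangent-line form that
only needs an upper bound `t` on `tr ρσ`. -/
theorem re_trace_mul_log2Op_le {ρ σ : Op ι} (hρ : ρ.PosSemidef) (hσ : σ.PosSemidef)
    (htr : ρ.trace = 1) (hker : ∀ v : ι → ℂ, σ.mulVec v = 0 → ρ.mulVec v = 0) {t : ℝ} (ht : 0 < t)
    (h : (ρ * σ).trace.re ≤ t) : (ρ * log2Op σ).trace.re ≤ Real.logb 2 t := by
  set U : Op ι := (hσ.isHermitian.eigenvectorUnitary : Op ι) with hU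
  set lam := hσ.isHermitian.eigenvalues with hlam
  set W : Op ι := star U * ρ * U with hW
  have hWpsd : W.PosSemidef := hρ.conjTranspose_mul_mul_same U
  have hwnn : ∀ i, 0 ≤ (W i i).re := fun i => (Complex.le_def.1 hWpsd.diag_nonneg).1
  have hw0 : ∀ i, lam i = 0 → (W i i).re = 0 := by
    intro i hi
    have h1 : σ.mulVec (⇑(hσ.isHermitian.eigenvectorBasis i)) = 0 := by
      rw [hσ.isHermitian.mulVec_eigenvectorBasis i, ← hlam, hi, zero_smul]
    have h2 := hker _ h1
    have h3 : W i i = 0 := by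
      rw [hW, mul_assoc, Matrix.mul_apply]
      refine Finset.sum_eq_zero fun j _ => ?_
      have : (ρ * U) j i = ρ.mulVec (⇑(hσ.isHermitian.eigenvectorBasis i)) j := by
        simp [Matrix.mul_apply, Matrix.mulVec, dotProduct, hU]
      rw [this, h2]; simp
    rw [h3]; rfl
  have hsum : ∑ i, (W i i).re = 1 := by
    have : W.trace = 1 := by
      rw [hW, mul_assoc, Matrix.trace_mul_comm, mul_assoc]
      have : U * star U = 1 := Matrix.mem_unitaryGroup_iff.1 hσ.isHermitian.eigenvectorUnitary.2
      rw [this, mul_one, htr]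
    have h2 := congrArg Complex.re this
    simpa [Matrix.trace] using h2
  have hid : ∑ i, (W i i).re * lam i ≤ t := by
    have := trace_mul_cfc hσ.isHermitian ρ (fun x => x)
    rw [cfc_self hσ.isHermitian] at this
    rw [this] at h
    simpa [← hU, ← hlam, ← hW, Complex.mul_re] using h
  have hlog : (ρ * log2Op σ).trace.re = ∑ i, (W i i).re * Real.logb 2 (lam i) := by
    rw [log2Op, trace_mul_cfc hσ.isHermitian ρ]
    simp [← hU, ← hlam, ← hW, Complex.mul_re]
  have hl2 : 0 < Real.log 2 := Real.log_pos (by norm_num)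
  -- The tangent line of `log` at `t` bounds each term; a zero eigenvalue, where `logb` has a junk
  -- value, carries no weight.
  have hterm : ∀ i, (W i i).re * Real.logb 2 (lam i) ≤
      (W i i).re * (Real.logb 2 t - 1 / Real.log 2) + (W i i).re * lam i / (t * Real.log 2) := by
    intro i
    rcases (hσ.eigenvalues_nonneg i).eq_or_lt with h0 | h0
    · rw [hw0 i h0.symm]; simp
    · have h0' : 0 < lam i := h0
      have h1 := Real.log_le_sub_one_of_pos (div_pos h0' ht)
      rw [Real.log_div h0'.ne' ht.ne'] at h1
      have h2 : Real.logb 2 (lam i) ≤ Real.logb 2 t - 1 / Real.log 2 + lam i / (t * Real.log 2) := by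
        rw [Real.logb, Real.logb, ← div_div, ← sub_div, ← add_div]
        exact div_le_div_of_nonneg_right (by linarith) hl2.le
      have h3 := mul_le_mul_of_nonneg_left h2 (hwnn i)
      rw [mul_add, ← mul_div_assoc] at h3
      exact h3
  calc (ρ * log2Op σ).trace.re
      ≤ ∑ i, ((W i i).re * (Real.logb 2 t - 1 / Real.log 2)
          + (W i i).re * lam i / (t * Real.log 2)) := by
        rw [hlog]; exact Finset.sum_le_sum fun i _ => hterm i
    _ = (Real.logb 2 t - 1 / Real.log 2) + (∑ i, (W i i).re * lam i) / (t * Real.log 2) := by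
        rw [Finset.sum_add_distrib, ← Finset.sum_mul, hsum, one_mul, Finset.sum_div]
    _ ≤ (Real.logb 2 t - 1 / Real.log 2) + t / (t * Real.log 2) := by
        gcongr
    _ = Real.logb 2 t := by
        field_simp; ring

/-- For a normalized projection `ρ` of rank `1 / p`, the relative entropy to `σ` is at least
`-log tr Pσ`, where `P = ρ / p` is the support projection of `ρ`. -/
theorem neg_logb_le_relEntropy {ρ σ : Op ι} (hρ : ρ.PosSemidef) (hσ : σ.PosSemidef)
    (htr : ρ.trace = 1) {p : ℝ} (hp : 0 < p) (hsq : ρ * ρ = (p : ℂ) • ρ) {t : ℝ} (ht : 0 < t)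
    (h : (ρ * σ).trace.re ≤ p * t) : ((-Real.logb 2 t : ℝ) : EReal) ≤ relEntropy ρ σ := by
  rw [relEntropy]
  split_ifs with hker
  · have h1 := re_trace_mul_log2Op_le hρ hσ htr hker (mul_pos hp ht) h
    have h2 : (ρ * log2Op ρ).trace.re = Real.logb 2 p := by
      rw [log2Op_of_sq hρ.isHermitian hp.ne' hsq, Matrix.mul_smul, hsq, Matrix.trace_smul,
        Matrix.trace_smul, htr]
      simp [hp.ne']
    rw [EReal.coe_le_coe_iff, Matrix.trace_sub, Complex.sub_re, h2]
    rw [Real.logb_mul hp.ne' ht.ne'] at h1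
    linarith
  · exact le_top

/-- Relative entropy between normalized projections, the first dominated by the second. -/
theorem relEntropy_of_sq {ρ σ : Op ι} (hρ : ρ.PosSemidef) (hσ : σ.PosSemidef)
    (htr : ρ.trace = 1) {p q : ℝ} (hp : 0 < p) (hq : 0 < q)
    (hρsq : ρ * ρ = (p : ℂ) • ρ) (hσsq : σ * σ = (q : ℂ) • σ)
    (hρσ : ρ * σ = (q : ℂ) • ρ) :
    relEntropy ρ σ = ((Real.logb 2 p - Real.logb 2 q : ℝ) : EReal) := by
  have hker : ∀ v : ι → ℂ, σ.mulVec v = 0 → ρ.mulVec v = 0 := by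
    intro v hv
    have h1 : (ρ * σ).mulVec v = 0 := by rw [← Matrix.mulVec_mulVec, hv, Matrix.mulVec_zero]
    rw [hρσ, Matrix.smul_mulVec] at h1
    exact (smul_eq_zero.1 h1).resolve_left (by exact_mod_cast hq.ne')
  rw [relEntropy, if_pos hker, log2Op_of_sq hρ.isHermitian hp.ne' hρsq,
    log2Op_of_sq hσ.isHermitian hq.ne' hσsq, Matrix.mul_smul, Matrix.mul_smul, hρsq, hρσ]
  simp [Matrix.trace_sub, htr, hp.ne', hq.ne']

end SpectralFunctions

/-! ### Partial transposition -/

section PartialTranspose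

variable {α β : Type*}

@[simp] theorem partialTranspose_apply (X : Op (α × β)) (x y : α × β) :
    partialTranspose X x y = X (x.1, y.2) (y.1, x.2) := rfl

@[simp] theorem partialTranspose_partialTranspose (X : Op (α × β)) :
    partialTranspose (partialTranspose X) = X := rfl

theorem partialTranspose_sub (X Y : Op (α × β)) :
    partialTranspose (X - Y) = partialTranspose X - partialTranspose Y := rfl

theorem partialTranspose_smul (c : ℂ) (X : Op (α × β)) :
    partialTranspose (c • X) = c • partialTranspose X := rfl

theorem partialTranspose_isHermitian {X : Op (α × β)} (hX : X.IsHermitian) :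
    (partialTranspose X).IsHermitian := by
  ext x y
  exact hX.apply (x.1, y.2) (y.1, x.2)

theorem partialTranspose_one [DecidableEq α] [DecidableEq β] :
    partialTranspose (1 : Op (α × β)) = 1 := by
  ext ⟨a, b⟩ ⟨c, d⟩
  simp only [partialTranspose_apply, Matrix.one_apply, Prod.mk.injEq]
  congr 1
  simp [eq_comm]

variable [Fintype α] [Fintype β]

theorem trace_partialTranspose (X : Op (α × β)) : (partialTranspose X).trace = X.trace := rfl

/-- Partial transposition is self-adjoint for the trace pairing. -/
theorem trace_partialTranspose_mul (X Y : Op (α × β)) :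
    (partialTranspose X * Y).trace = (X * partialTranspose Y).trace := by
  simp only [Matrix.trace, Matrix.diag, Matrix.mul_apply, Fintype.sum_prod_type,
    partialTranspose_apply]
  refine Finset.sum_congr rfl fun a _ => ?_
  rw [Finset.sum_comm]
  conv_rhs => rw [Finset.sum_comm]
  exact Finset.sum_congr rfl fun c _ => Finset.sum_comm

end PartialTranspose

/-! ### Tensor powers -/

section TensorPower

variable {α β : Type*} {n : ℕ}

/-- The tensor product `⨂ᵢ Mᵢ` of bipartite operators, with Alice's systems grouped together and
Bob's systems grouped together. -/
def tensorFamily (M : Fin n → Op (α × β)) : Op ((Fin n → α) × (Fin n → β)) :=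
  Matrix.of fun x y => ∏ i, M i (x.1 i, x.2 i) (y.1 i, y.2 i)

@[simp] theorem tensorPower_apply (ρ : Op (α × β)) (x y : (Fin n → α) × (Fin n → β)) :
    tensorPower ρ n x y = ∏ i, ρ (x.1 i, x.2 i) (y.1 i, y.2 i) := rfl

theorem partialTranspose_tensorPower (X : Op (α × β)) :
    partialTranspose (tensorPower X n) = tensorPower (partialTranspose X) n := rfl

theorem tensorPower_smul (c : ℂ) (X : Op (α × β)) :
    tensorPower (c • X) n = c ^ n • tensorPower X n := by
  ext x y
  simp [Finset.prod_mul_distrib]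

theorem tensorPower_isHermitian {X : Op (α × β)} (hX : X.IsHermitian) :
    (tensorPower X n).IsHermitian := by
  ext x y
  simp only [Matrix.conjTranspose_apply, tensorPower_apply, star_prod]
  exact Finset.prod_congr rfl fun i _ => hX.apply _ _

theorem tensorPower_one [DecidableEq α] [DecidableEq β] :
    tensorPower (1 : Op (α × β)) n = 1 := by
  ext ⟨a, b⟩ ⟨c, d⟩
  simp only [tensorPower_apply, Matrix.one_apply, Prod.mk.injEq, funext_iff]
  rw [Finset.prod_ite_zero]
  simp [forall_and]

/-- Summation over `n` pairs factorizes. -/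
theorem sum_prod_pair [Fintype α] [Fintype β] (f : Fin n → α × β → ℂ) :
    ∑ x : (Fin n → α) × (Fin n → β), ∏ i, f i (x.1 i, x.2 i) = ∏ i, ∑ z, f i z := by
  rw [Finset.prod_univ_sum, Fintype.piFinset_univ]
  exact (Fintype.sum_equiv (Equiv.arrowProdEquivProdArrow (Fin n) (fun _ => α) (fun _ => β))
    _ _ fun x => rfl).symm

theorem tensorPower_mul [Fintype α] [Fintype β] (X Y : Op (α × β)) :
    tensorPower (X * Y) n = tensorPower X n * tensorPower Y n := by
  ext x y
  simp only [tensorPower_apply, Matrix.mul_apply, ← Finset.prod_mul_distrib]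
  exact (sum_prod_pair fun i z => X (x.1 i, x.2 i) z * Y z (y.1 i, y.2 i)).symm

theorem trace_tensorPower [Fintype α] [Fintype β] (X : Op (α × β)) :
    (tensorPower X n).trace = X.trace ^ n := by
  have := sum_prod_pair (n := n) fun _ z => X z z
  simpa [Matrix.trace] using this

/-- The tensor product is a Hadamard product of submatrices, so Schur's product theorem applies. -/
theorem tensorFamily_posSemidef [Finite α] [Finite β] {M : Fin n → Op (α × β)}
    (hM : ∀ i, (M i).PosSemidef) : (tensorFamily M).PosSemidef := by
  have key : ∀ s : Finset (Fin n), (Matrix.of fun x y : (Fin n → α) × (Fin n → β) =>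
      ∏ i ∈ s, M i (x.1 i, x.2 i) (y.1 i, y.2 i)).PosSemidef := by
    intro s
    induction s using Finset.induction_on with
    | empty =>
      have := Matrix.posSemidef_vecMulVec_self_star (fun _ : (Fin n → α) × (Fin n → β) => (1 : ℂ))
      convert this using 1
      ext x y
      simp [Matrix.vecMulVec_apply]
    | insert a s ha ih =>
      have h1 := ((hM a).submatrix fun x : (Fin n → α) × (Fin n → β) => (x.1 a, x.2 a)).hadamard ih
      refine (congrArg Matrix.PosSemidef ?_).mpr h1
      ext x y
      simp [Finset.prod_insert ha]
  exact key Finset.univ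

theorem tensorPower_posSemidef [Finite α] [Finite β] {X : Op (α × β)} (hX : X.PosSemidef) :
    (tensorPower X n).PosSemidef :=
  tensorFamily_posSemidef fun _ => hX

/-- Expansion of `(A + c B)^{⊗ n}` into products of `A`s and `B`s. -/
theorem tensorPower_add_smul (A B : Op (α × β)) (c : ℂ) :
    tensorPower (A + c • B) n =
      ∑ s : Finset (Fin n), c ^ sᶜ.card • tensorFamily fun i => if i ∈ s then A else B := by
  ext x y
  simp only [tensorPower_apply, Matrix.add_apply, Matrix.smul_apply, smul_eq_mul,
    Matrix.sum_apply, tensorFamily, Matrix.of_apply]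
  rw [Finset.prod_add]
  rw [Finset.powerset_univ]
  refine Finset.sum_congr rfl fun s _ => ?_
  rw [Finset.prod_mul_distrib, Finset.prod_const, ← Finset.compl_eq_univ_sdiff, mul_left_comm,
    ← Finset.prod_mul_prod_compl s
      (fun i => (if i ∈ s then A else B) (x.1 i, x.2 i) (y.1 i, y.2 i))]
  congr 2
  · exact Finset.prod_congr rfl fun i hi => by rw [if_pos hi]
  · exact Finset.prod_congr rfl fun i hi => by rw [if_neg (Finset.mem_compl.1 hi)]

/-- Positivity of `a (A + c B)^{⊗ n} + b (A + d B)^{⊗ n}`, term by term in the expansion: a product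
with `k` factors `B` has coefficient `a c^k + b d^k`. -/
theorem tensorPower_combination_posSemidef [Finite α] [Finite β] {A B : Op (α × β)}
    (hA : A.PosSemidef) (hB : B.PosSemidef) (a b c d : ℂ)
    (h : ∀ k : ℕ, k ≤ n → 0 ≤ a * c ^ k + b * d ^ k) :
    (a • tensorPower (A + c • B) n + b • tensorPower (A + d • B) n).PosSemidef := by
  rw [tensorPower_add_smul, tensorPower_add_smul, Finset.smul_sum, Finset.smul_sum,
    ← Finset.sum_add_distrib]
  refine Matrix.posSemidef_sum _ fun s _ => ?_
  rw [smul_smul, smul_smul, ← add_smul]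
  refine (tensorFamily_posSemidef fun i => ?_).smul (h _ ?_)
  · split_ifs
    exacts [hA, hB]
  · exact (Finset.card_le_univ _).trans (by simp)

/-- If `0 ≤ A ≤ B` then `A^{⊗ n} ≤ B^{⊗ n}`. -/
theorem tensorPower_mono [Finite α] [Finite β] {A B : Op (α × β)} (hA : A.PosSemidef)
    (h : (B - A).PosSemidef) : (tensorPower B n - tensorPower A n).PosSemidef := by
  have := tensorPower_combination_posSemidef (n := n) hA h 1 (-1) 1 0 fun k _ => by
    rcases k with _ | k <;> simp
  simpa [sub_eq_add_neg] using this

/-- If `-Y ≤ X ≤ Y` then `X^{⊗ n} ≤ Y^{⊗ n}`: writing `X = A - B` and `Y = A + B` with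
`A, B ≥ 0`, the difference is a combination of products of `A`s and `B`s with coefficients
`1 - (-1)^k`. -/
theorem tensorPower_sub_posSemidef [Finite α] [Finite β] {X Y : Op (α × β)}
    (h1 : (Y - X).PosSemidef) (h2 : (Y + X).PosSemidef) :
    (tensorPower Y n - tensorPower X n).PosSemidef := by
  have hh : (0 : ℂ) ≤ 1 / 2 := by norm_num [Complex.le_def]
  have := tensorPower_combination_posSemidef (n := n) (h2.smul hh) (h1.smul hh) 1 (-1) 1 (-1)
    fun k _ => by rcases neg_one_pow_eq_or ℂ k with h | h <;> norm_num [h, Complex.le_def]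
  convert this using 1
  have e1 : Y = (1 / 2 : ℂ) • (Y + X) + (1 : ℂ) • (1 / 2 : ℂ) • (Y - X) := by
    ext i j; simp; ring
  have e2 : X = (1 / 2 : ℂ) • (Y + X) + (-1 : ℂ) • (1 / 2 : ℂ) • (Y - X) := by
    ext i j; simp; ring
  rw [← e1, ← e2, one_smul, neg_one_smul, sub_eq_add_neg]

end TensorPower

/-! ### Choi matrices and PPT operations -/

section Choi

variable {α β α' β' : Type*}
  [Fintype α] [DecidableEq α] [Fintype β] [DecidableEq β]
  [Fintype α'] [DecidableEq α'] [Fintype β'] [DecidableEq β']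

omit [DecidableEq β] [Fintype β] in
theorem choi_apply (N : Op α →ₗ[ℂ] Op β) (i j : α) (k l : β) :
    choi N (i, k) (j, l) = N (Matrix.single i j 1) k l := by
  simp only [choi, Matrix.sum_apply, Matrix.kroneckerMap_apply, Matrix.single_apply, ite_mul,
    one_mul, zero_mul]
  rw [Finset.sum_eq_single i, Finset.sum_eq_single j] <;> simp +contextual

omit [DecidableEq β] [Fintype β] in
theorem apply_eq_sum_choi (N : Op α →ₗ[ℂ] Op β) (X : Op α) (k l : β) :
    N X k l = ∑ i, ∑ j, X i j * choi N (i, k) (j, l) := by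
  conv_lhs => rw [Matrix.matrix_eq_sum_single X]
  simp only [map_sum, Matrix.sum_apply, choi_apply]
  refine Finset.sum_congr rfl fun i _ => Finset.sum_congr rfl fun j _ => ?_
  have : Matrix.single i j (X i j) = X i j • Matrix.single i j (1 : ℂ) := by simp
  rw [this, map_smul]
  rfl

omit [DecidableEq β] in
/-- Contracting a positive semidefinite `X` on `κ × α` with a positive semidefinite `C` on `α × β`
over the common index gives a positive semidefinite operator. With `X = Bᴴ B` it is a sum of
operators `Wᴴ C W`. -/
theorem contraction_posSemidef {κ : Type*} [Fintype κ] [DecidableEq κ] {X : Op (κ × α)}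
    (hX : X.PosSemidef) {C : Op (α × β)} (hC : C.PosSemidef) :
    (Matrix.of fun x y : κ × β =>
      ∑ i, ∑ j, X (x.1, i) (y.1, j) * C (i, x.2) (j, y.2)).PosSemidef := by
  classical
  obtain ⟨B, rfl⟩ := exists_eq_conjTranspose_mul_self hX
  let W : κ × α → Matrix (α × β) (κ × β) ℂ := fun m =>
    Matrix.of fun p q => if p.2 = q.2 then B m (q.1, p.1) else 0
  have : (Matrix.of fun x y : κ × β => ∑ i, ∑ j,
      (B.conjTranspose * B) (x.1, i) (y.1, j) * C (i, x.2) (j, y.2))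
      = ∑ m, (W m).conjTranspose * C * W m := by
    ext ⟨a, k⟩ ⟨b, l⟩
    simp only [Matrix.of_apply, Matrix.sum_apply, Matrix.mul_apply, Fintype.sum_prod_type (α₁ := α),
      Matrix.conjTranspose_apply, W, apply_ite star, star_zero, ite_mul, zero_mul, mul_ite,
      mul_zero, Finset.sum_ite_eq', Finset.mem_univ, if_true, Finset.sum_mul]
    rw [Finset.sum_comm]
    simp only [Finset.sum_comm (s := (Finset.univ : Finset α)) (t := (Finset.univ : Finset (κ × α)))]
    refine Finset.sum_congr rfl fun m _ => ?_
    refine Finset.sum_congr rfl fun i _ => Finset.sum_congr rfl fun j _ => by ring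
  rw [this]
  exact Matrix.posSemidef_sum _ fun m _ => hC.conjTranspose_mul_mul_same _

omit [DecidableEq β] in
theorem apply_posSemidef_of_choi {N : Op α →ₗ[ℂ] Op β} (hN : (choi N).PosSemidef) {X : Op α}
    (hX : X.PosSemidef) : (N X).PosSemidef := by
  have := (contraction_posSemidef (hX.submatrix (Prod.snd : Unit × α → α)) hN).submatrix
    (fun k : β => ((), k))
  convert this using 1
  ext k l
  simp [apply_eq_sum_choi N X]

omit [DecidableEq β] in
/-- Choi's theorem: a positive semidefinite Choi matrix gives complete positivity. -/
theorem isCompletelyPositive_of_choi {N : Op α →ₗ[ℂ] Op β} (hN : (choi N).PosSemidef) :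
    IsCompletelyPositive N := by
  intro k X hX
  have := contraction_posSemidef hX hN
  convert this using 1
  ext x y
  simp [ampliation, apply_eq_sum_choi N]

omit [DecidableEq α'] [DecidableEq β'] [Fintype α'] [Fintype β'] in
theorem bipartiteChoi_apply (Λ : Op (α × β) →ₗ[ℂ] Op (α' × β')) (x y : (α × α') × (β × β')) :
    bipartiteChoi Λ x y = Λ (Matrix.single (x.1.1, x.2.1) (y.1.1, y.2.1) 1)
      (x.1.2, x.2.2) (y.1.2, y.2.2) := by
  simp [bipartiteChoi, choi_apply]

omit [DecidableEq α'] [DecidableEq β'] [Fintype α'] [Fintype β'] in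
theorem bipartiteChoi_posSemidef_iff (Λ : Op (α × β) →ₗ[ℂ] Op (α' × β')) :
    (bipartiteChoi Λ).PosSemidef ↔ (choi Λ).PosSemidef :=
  Matrix.posSemidef_submatrix_equiv _

omit [DecidableEq α'] [DecidableEq β'] in
theorem isPPTOperation_of_bipartiteChoi {Λ : Op (α × β) →ₗ[ℂ] Op (α' × β')}
    (htr : ∀ X, (Λ X).trace = X.trace) (h : IsPPT (bipartiteChoi Λ)) : IsPPTOperation Λ :=
  ⟨⟨isCompletelyPositive_of_choi ((bipartiteChoi_posSemidef_iff Λ).1 h.1), htr⟩, h⟩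

/-- Partial transposition as a linear map. -/
def partialTransposeMap (α β : Type*) : Op (α × β) →ₗ[ℂ] Op (α × β) where
  toFun := partialTranspose
  map_add' _ _ := rfl
  map_smul' _ _ := rfl

/-- The map `Λ^Γ = T_B ∘ Λ ∘ T_B`. -/
def ptConj (Λ : Op (α × β) →ₗ[ℂ] Op (α' × β')) : Op (α × β) →ₗ[ℂ] Op (α' × β') :=
  partialTransposeMap α' β' ∘ₗ Λ ∘ₗ partialTransposeMap α β

omit [DecidableEq α] [DecidableEq β] [DecidableEq α'] [DecidableEq β'] [Fintype α] [Fintype β]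
  [Fintype α'] [Fintype β'] in
theorem ptConj_apply (Λ : Op (α × β) →ₗ[ℂ] Op (α' × β')) (X : Op (α × β)) :
    ptConj Λ X = partialTranspose (Λ (partialTranspose X)) := rfl

omit [Fintype α] [Fintype β] in
theorem partialTranspose_single (a c : α) (b d : β) :
    partialTranspose (Matrix.single (a, b) (c, d) (1 : ℂ)) = Matrix.single (a, d) (c, b) 1 := by
  ext ⟨x, y⟩ ⟨z, w⟩
  simp only [partialTranspose_apply, Matrix.single_apply, Prod.mk.injEq]
  congr 1
  apply propext
  tauto

omit [DecidableEq α'] [DecidableEq β'] [Fintype α'] [Fintype β'] in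
theorem bipartiteChoi_ptConj (Λ : Op (α × β) →ₗ[ℂ] Op (α' × β')) :
    bipartiteChoi (ptConj Λ) = partialTranspose (bipartiteChoi Λ) := by
  ext ⟨⟨a, a'⟩, ⟨b, b'⟩⟩ ⟨⟨c, c'⟩, ⟨d, d'⟩⟩
  simp [bipartiteChoi_apply, ptConj_apply, partialTranspose_single]

omit [DecidableEq α'] [DecidableEq β'] in
theorem IsPPTOperation.posSemidef {Λ : Op (α × β) →ₗ[ℂ] Op (α' × β')} (hΛ : IsPPTOperation Λ)
    {X : Op (α × β)} (hX : X.PosSemidef) : (Λ X).PosSemidef :=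
  apply_posSemidef_of_choi ((bipartiteChoi_posSemidef_iff Λ).1 hΛ.2.1) hX

omit [DecidableEq α'] [DecidableEq β'] in
/-- `Λ^Γ` is a positive map when `Λ` is a PPT operation. -/
theorem IsPPTOperation.ptConj_posSemidef {Λ : Op (α × β) →ₗ[ℂ] Op (α' × β')}
    (hΛ : IsPPTOperation Λ) {X : Op (α × β)} (hX : X.PosSemidef) : (ptConj Λ X).PosSemidef := by
  refine apply_posSemidef_of_choi ((bipartiteChoi_posSemidef_iff _).1 ?_) hX
  rw [bipartiteChoi_ptConj]
  exact hΛ.2.2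

omit [DecidableEq α'] [DecidableEq β'] in
/-- PPT operations preserve PPT operators. -/
theorem IsPPTOperation.isPPT {Λ : Op (α × β) →ₗ[ℂ] Op (α' × β')} (hΛ : IsPPTOperation Λ)
    {X : Op (α × β)} (hX : IsPPT X) : IsPPT (Λ X) :=
  ⟨hΛ.posSemidef hX.1, by simpa [ptConj_apply] using hΛ.ptConj_posSemidef hX.2⟩

end Choi

/-! ### The maximally entangled state -/

section MaxEntangled

variable {d : ℕ}

theorem maxEntangled_apply (x y : Fin d × Fin d) :
    maxEntangled d x y = if x.1 = x.2 ∧ y.1 = y.2 then (1 / d : ℂ) else 0 := by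
  obtain ⟨a, b⟩ := x
  obtain ⟨a', b'⟩ := y
  simp only [maxEntangled, Matrix.smul_apply, Matrix.sum_apply, Matrix.single_apply, smul_eq_mul,
    Prod.mk.injEq]
  rw [Finset.sum_eq_single a, Finset.sum_eq_single a']
  · simp
  · intro j _ hj
    rw [if_neg (by tauto)]
  · simp
  · intro i _ hi
    exact Finset.sum_eq_zero fun j _ => by rw [if_neg (by tauto)]
  · simp

/-- The flip operator `|ij⟩ ↦ |ji⟩`. -/
def flipOp (d : ℕ) : Op (Fin d × Fin d) :=
  Matrix.of fun x y => if x.1 = y.2 ∧ y.1 = x.2 then 1 else 0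

theorem flipOp_isHermitian : (flipOp d).IsHermitian := by
  ext x y
  simp only [flipOp, Matrix.conjTranspose_apply, Matrix.of_apply, apply_ite star, star_one,
    star_zero]
  congr 1
  simp [and_comm]

theorem flipOp_mul_flipOp : flipOp d * flipOp d = 1 := by
  ext ⟨a, b⟩ ⟨c, e⟩
  simp only [flipOp, Matrix.mul_apply, Matrix.of_apply, Matrix.one_apply, Prod.mk.injEq]
  rw [Finset.sum_eq_single (b, a)]
  · simp [and_comm, eq_comm]
  · rintro ⟨z, w⟩ _ h
    have : ¬ (a = w ∧ z = b) := fun h' => h (by rw [h'.1, h'.2])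
    simp [this]
  · simp

theorem one_sub_flipOp_posSemidef : (1 - flipOp d).PosSemidef :=
  one_sub_posSemidef_of_cube flipOp_isHermitian (by rw [flipOp_mul_flipOp, one_mul])

theorem one_add_flipOp_posSemidef : (1 + flipOp d).PosSemidef :=
  one_add_posSemidef_of_cube flipOp_isHermitian (by rw [flipOp_mul_flipOp, one_mul])

theorem partialTranspose_maxEntangled :
    partialTranspose (maxEntangled d) = (1 / d : ℂ) • flipOp d := by
  ext x y
  simp [maxEntangled_apply, flipOp]

theorem maxEntangled_isHermitian : (maxEntangled d).IsHermitian := by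
  ext x y
  simp only [Matrix.conjTranspose_apply, maxEntangled_apply, apply_ite star, star_zero]
  simp [and_comm]

theorem trace_maxEntangled (hd : d ≠ 0) : (maxEntangled d).trace = 1 := by
  simp [Matrix.trace, maxEntangled_apply, Fintype.sum_prod_type, hd]

/-- The unnormalized maximally correlated operator `∑ᵢ |ii⟩⟨ii|`. -/
def maxCorrelated (d : ℕ) : Op (Fin d × Fin d) :=
  Matrix.diagonal fun x => if x.1 = x.2 then 1 else 0

theorem maxEntangled_mul_maxCorrelated : maxEntangled d * maxCorrelated d = maxEntangled d := by
  ext x y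
  simp only [maxCorrelated, Matrix.mul_diagonal, maxEntangled_apply]
  split_ifs <;> simp_all

theorem maxCorrelated_mul_maxEntangled : maxCorrelated d * maxEntangled d = maxEntangled d := by
  ext x y
  simp only [maxCorrelated, Matrix.diagonal_mul, maxEntangled_apply]
  split_ifs <;> simp_all

theorem maxEntangled_mul_self : maxEntangled d * maxEntangled d = maxEntangled d := by
  ext x y
  rcases Nat.eq_zero_or_pos d with h | h
  · subst h; exact x.1.elim0
  have hd : (d : ℂ) ≠ 0 := by exact_mod_cast h.ne'
  simp only [Matrix.mul_apply, maxEntangled_apply, Fintype.sum_prod_type]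
  by_cases hx : x.1 = x.2 <;> by_cases hy : y.1 = y.2 <;> simp [hx, hy, hd]

theorem maxEntangled_posSemidef : (maxEntangled d).PosSemidef :=
  posSemidef_of_idempotent maxEntangled_isHermitian maxEntangled_mul_self

theorem one_sub_maxEntangled_posSemidef : (1 - maxEntangled d).PosSemidef :=
  one_sub_posSemidef_of_cube maxEntangled_isHermitian (by simp only [maxEntangled_mul_self])

theorem maxCorrelated_posSemidef : (maxCorrelated d).PosSemidef := by
  refine Matrix.PosSemidef.diagonal fun x => ?_
  dsimp only
  split_ifs <;> simp

theorem partialTranspose_diagonal {α β : Type*} [DecidableEq α] [DecidableEq β] (f : α × β → ℂ) :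
    partialTranspose (Matrix.diagonal f) = Matrix.diagonal f := by
  ext ⟨a, b⟩ ⟨c, e⟩
  simp only [partialTranspose_apply, Matrix.diagonal_apply, Prod.mk.injEq]
  by_cases h : a = c <;> by_cases h' : b = e <;> simp [h, h', eq_comm]

theorem maxCorrelated_isPPT : IsPPT (maxCorrelated d) :=
  ⟨maxCorrelated_posSemidef, by
    rw [maxCorrelated, partialTranspose_diagonal]; exact maxCorrelated_posSemidef⟩

theorem trace_maxCorrelated : (maxCorrelated d).trace = d := by
  simp only [maxCorrelated, Matrix.trace_diagonal, Fintype.sum_prod_type]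
  simp

theorem maxCorrelated_sub_maxEntangled_posSemidef :
    (maxCorrelated d - maxEntangled d).PosSemidef := by
  refine posSemidef_of_idempotent
    (maxCorrelated_posSemidef.isHermitian.sub maxEntangled_isHermitian) ?_
  have : maxCorrelated d * maxCorrelated d = maxCorrelated d := by
    simp [maxCorrelated, Matrix.diagonal_mul_diagonal]
  rw [mul_sub, sub_mul, sub_mul, this, maxEntangled_mul_self, maxEntangled_mul_maxCorrelated,
    maxCorrelated_mul_maxEntangled]
  simp

end MaxEntangled

/-! ### Converse bounds and conversion errors -/

section Converses

variable {α β α' β' : Type*}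
  [Fintype α] [DecidableEq α] [Fintype β] [DecidableEq β]
  [Fintype α'] [DecidableEq α'] [Fintype β'] [DecidableEq β']

omit [DecidableEq α'] [DecidableEq β'] in
theorem IsPPTOperation.trace_eq {Λ : Op (α × β) →ₗ[ℂ] Op (α' × β')} (hΛ : IsPPTOperation Λ)
    (X : Op (α × β)) : (Λ X).trace = X.trace := hΛ.1.2 X

/-- Rains' converse: the fidelity with `Φ(d)` reachable from `ρ` by PPT operations is at most
`‖ρ^Γ‖₁ / d`, since `Φ(d)^Γ` has operator norm `1 / d` and `Λ^Γ` is positive and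
trace-preserving. -/
theorem re_trace_maxEntangled_mul_le {d : ℕ} {Λ : Op (α × β) →ₗ[ℂ] Op (Fin d × Fin d)}
    (hΛ : IsPPTOperation Λ) {ρ : Op (α × β)} (hρ : ρ.IsHermitian) :
    (maxEntangled d * Λ ρ).trace.re ≤ 1 / d * traceNorm (partialTranspose ρ) := by
  have hX := partialTranspose_isHermitian hρ
  have hd : (0 : ℂ) ≤ 1 / d := by
    rw [one_div]; exact inv_nonneg.2 (Nat.cast_nonneg d)
  have e : ((1 / d : ℝ) : ℂ) = 1 / d := by push_cast; rfl
  have h1 : (((1 / d : ℝ) : ℂ) • 1 - partialTranspose (maxEntangled d)).PosSemidef := by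
    rw [partialTranspose_maxEntangled, e, ← smul_sub]
    exact one_sub_flipOp_posSemidef.smul hd
  have h2 : (((1 / d : ℝ) : ℂ) • 1 + partialTranspose (maxEntangled d)).PosSemidef := by
    rw [partialTranspose_maxEntangled, e, ← smul_add]
    exact one_add_flipOp_posSemidef.smul hd
  have h3 := hΛ.ptConj_posSemidef (absOp_sub_posSemidef hX)
  have h4 := hΛ.ptConj_posSemidef (absOp_add_posSemidef hX)
  rw [map_sub] at h3
  rw [map_add] at h4
  have h5 := re_trace_mul_le_of_bounds h1 h2 h3 h4
  rw [trace_partialTranspose_mul] at h5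
  rw [ptConj_apply, ptConj_apply, trace_partialTranspose, hΛ.trace_eq, trace_partialTranspose] at h5
  exact h5

/-- If every PPT operator `ω` satisfies `tr P ω ≤ q tr ω`, then the overlap with `P` reachable from
`Φ(d)` by PPT operations is at most `d q`, because `Φ(d) ≤ ∑ᵢ |ii⟩⟨ii|` and the right side is
PPT. -/
theorem re_trace_mul_apply_maxEntangled_le {d : ℕ} {Λ : Op (Fin d × Fin d) →ₗ[ℂ] Op (α × β)}
    (hΛ : IsPPTOperation Λ) {P : Op (α × β)} (hP : P.PosSemidef) {q : ℝ}
    (h : ∀ ω : Op (α × β), IsPPT ω → (P * ω).trace.re ≤ q * ω.trace.re) :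
    (P * Λ (maxEntangled d)).trace.re ≤ q * d := by
  have h1 := hΛ.posSemidef (maxCorrelated_sub_maxEntangled_posSemidef (d := d))
  rw [map_sub] at h1
  have h2 := re_trace_mul_mono_left h1 hP
  rw [Matrix.trace_mul_comm, Matrix.trace_mul_comm (Λ (maxCorrelated d))] at h2
  have h3 := h _ (hΛ.isPPT (maxCorrelated_isPPT (d := d)))
  rw [hΛ.trace_eq, trace_maxCorrelated, Complex.natCast_re] at h3
  exact h2.trans h3

theorem re_trace_mul_sub_traceNorm_le {ι : Type*} [Fintype ι] [DecidableEq ι] {G ω τ : Op ι}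
    (hG : G.PosSemidef) (hG1 : (1 - G).PosSemidef) (hω : ω.IsHermitian) (hτ : τ.IsHermitian) :
    (G * τ).trace.re - traceNorm (ω - τ) ≤ (G * ω).trace.re := by
  have h1 : (((1 : ℝ) : ℂ) • (1 : Op ι) - -G).PosSemidef := by
    simpa using Matrix.PosSemidef.one.add hG
  have h2 : (((1 : ℝ) : ℂ) • (1 : Op ι) + -G).PosSemidef := by
    simpa [sub_eq_add_neg] using hG1
  have h3 := re_trace_mul_le_traceNorm h1 h2 (hω.sub hτ)
  simp only [Matrix.neg_mul, mul_sub, Matrix.trace_neg, Matrix.trace_sub, Complex.neg_re,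
    Complex.sub_re] at h3
  linarith

theorem exists_of_conversionError_lt {ρ : Op (α × β)} {τ : Op (α' × β')} {ε : ℝ} (hε : 0 < ε)
    (h : conversionError ρ τ < ENNReal.ofReal ε) :
    ∃ Λ : Op (α × β) →ₗ[ℂ] Op (α' × β'), IsPPTOperation Λ ∧ traceNorm (Λ ρ - τ) < ε := by
  simp only [conversionError, iInf_lt_iff] at h
  obtain ⟨Λ, hΛ, h⟩ := h
  exact ⟨Λ, hΛ, (ENNReal.ofReal_lt_ofReal_iff hε).1 h⟩

theorem conversionError_eq_zero {ρ : Op (α × β)} {τ : Op (α' × β')}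
    {Λ : Op (α × β) →ₗ[ℂ] Op (α' × β')} (hΛ : IsPPTOperation Λ) (h : Λ ρ = τ) :
    conversionError ρ τ = 0 := by
  refine le_antisymm ?_ bot_le
  refine (iInf₂_le Λ hΛ).trans ?_
  rw [h, sub_self, traceNorm_zero, ENNReal.ofReal_zero]

end Converses

/-! ### Measure-and-prepare operations -/

section MeasurePrepare

variable {α β : Type*} [Fintype α] [DecidableEq α] [Fintype β] [DecidableEq β]

/-- The binary test `{F, 1 - F}` followed by the preparation of `Φ(d)` or of the normalized
complement `(1 - Φ(d)) / (d² - 1)`. It preserves the trace only for `d ≥ 2`: at `d = 1` the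
complement vanishes. -/
noncomputable def testAndPrepare (F : Op (α × β)) (d : ℕ) :
    Op (α × β) →ₗ[ℂ] Op (Fin d × Fin d) where
  toFun X := (F * X).trace • maxEntangled d +
    ((1 - F) * X).trace • (1 / ((d : ℂ) ^ 2 - 1)) • (1 - maxEntangled d)
  map_add' X Y := by
    simp only [mul_add, Matrix.trace_add, add_smul]
    abel
  map_smul' c X := by
    simp only [Matrix.mul_smul, Matrix.trace_smul, smul_eq_mul, mul_smul, RingHom.id_apply,
      smul_add]

theorem testAndPrepare_apply (F : Op (α × β)) (d : ℕ) (X : Op (α × β)) :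
    testAndPrepare F d X = (F * X).trace • maxEntangled d +
      ((1 - F) * X).trace • (1 / ((d : ℂ) ^ 2 - 1)) • (1 - maxEntangled d) := rfl

theorem bipartiteChoi_testAndPrepare (F : Op (α × β)) (d : ℕ) :
    bipartiteChoi (testAndPrepare F d) =
      (F.transpose ⊗ₖ maxEntangled d + (1 - F).transpose ⊗ₖ
        ((1 / ((d : ℂ) ^ 2 - 1)) • (1 - maxEntangled d))).submatrix
        (Equiv.prodProdProdComm α (Fin d) β (Fin d))
        (Equiv.prodProdProdComm α (Fin d) β (Fin d)) := by
  ext x y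
  simp [bipartiteChoi_apply, testAndPrepare_apply, Matrix.trace_mul_single, -mul_eq_mul_right_iff,
    Matrix.one_apply, eq_comm]

/-- The partial transpose of the Choi matrix splits along the eigenspaces of the flip, with
coefficients proportional to `1 ± d F^Γ`. -/
theorem partialTranspose_bipartiteChoi_testAndPrepare (F : Op (α × β)) {d : ℕ} (hd : 2 ≤ d) :
    partialTranspose (bipartiteChoi (testAndPrepare F d)) =
      ((1 / ((d : ℂ) * (d + 1))) • ((1 + (d : ℂ) • partialTranspose F).transpose ⊗ₖ
          ((1 / 2 : ℂ) • (1 + flipOp d))) +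
        (1 / ((d : ℂ) * (d - 1))) • ((1 - (d : ℂ) • partialTranspose F).transpose ⊗ₖ
          ((1 / 2 : ℂ) • (1 - flipOp d)))).submatrix
        (Equiv.prodProdProdComm α (Fin d) β (Fin d))
        (Equiv.prodProdProdComm α (Fin d) β (Fin d)) := by
  have h0 : (d : ℂ) ≠ 0 := by exact_mod_cast (by omega : d ≠ 0)
  have h1 : (d : ℂ) - 1 ≠ 0 := by
    rw [sub_ne_zero]; exact_mod_cast (by omega : d ≠ 1)
  have h2 : (d : ℂ) + 1 ≠ 0 := by exact_mod_cast (by omega : d + 1 ≠ 0)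
  have h3 : (d : ℂ) ^ 2 - 1 ≠ 0 := by
    have : (d : ℂ) ^ 2 - 1 = (d - 1) * (d + 1) := by ring
    rw [this]; exact mul_ne_zero h1 h2
  rw [bipartiteChoi_testAndPrepare]
  ext ⟨⟨a, a'⟩, ⟨b, b'⟩⟩ ⟨⟨c, c'⟩, ⟨e, e'⟩⟩
  have hΦ := congrFun (congrFun (partialTranspose_maxEntangled (d := d)) (a', b')) (c', e')
  have hI := congrFun (congrFun (partialTranspose_one (α := Fin d) (β := Fin d)) (a', b')) (c', e')
  have hJ := congrFun (congrFun (partialTranspose_one (α := α) (β := β)) (c, e)) (a, b)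
  simp only [partialTranspose_apply, Matrix.smul_apply, smul_eq_mul] at hΦ hI hJ
  simp only [partialTranspose_apply, Matrix.submatrix_apply, Equiv.prodProdProdComm_apply,
    Matrix.add_apply, Matrix.sub_apply, Matrix.smul_apply, Matrix.kroneckerMap_apply,
    Matrix.transpose_apply, smul_eq_mul, hΦ, hI, hJ]
  generalize flipOp d (a', b') (c', e') = s
  generalize F (c, b) (a, e) = f
  generalize (1 : Op (Fin d × Fin d)) (a', b') (c', e') = u
  generalize (1 : Op (α × β)) (c, e) (a, b) = v
  have h3' : (d : ℂ) ^ 2 - 1 = (d - 1) * (d + 1) := by ring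
  rw [h3']
  field_simp
  ring

/-- A test `0 ≤ F ≤ 1` with `-1/d ≤ F^Γ ≤ 1/d` gives a PPT operation. -/
theorem testAndPrepare_isPPTOperation {F : Op (α × β)} {d : ℕ} (hd : 2 ≤ d) (hF : F.PosSemidef)
    (hF1 : (1 - F).PosSemidef) (h1 : (1 - (d : ℂ) • partialTranspose F).PosSemidef)
    (h2 : (1 + (d : ℂ) • partialTranspose F).PosSemidef) :
    IsPPTOperation (testAndPrepare F d) := by
  have hd' : (2 : ℝ) ≤ d := by exact_mod_cast hd
  have hsq : (0 : ℝ) < (d : ℝ) ^ 2 - 1 := by nlinarith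
  have hh : (0 : ℂ) ≤ 1 / 2 := by norm_num [Complex.le_def]
  have c1 : (0 : ℂ) ≤ 1 / ((d : ℂ) ^ 2 - 1) := by
    simpa using Complex.zero_le_real.2 (by positivity : (0 : ℝ) ≤ 1 / ((d : ℝ) ^ 2 - 1))
  have c2 : (0 : ℂ) ≤ 1 / ((d : ℂ) * (d + 1)) := by
    simpa using Complex.zero_le_real.2 (by positivity : (0 : ℝ) ≤ 1 / ((d : ℝ) * (d + 1)))
  have c3 : (0 : ℂ) ≤ 1 / ((d : ℂ) * (d - 1)) := by
    have : (0 : ℝ) ≤ (d : ℝ) - 1 := by linarith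
    simpa using Complex.zero_le_real.2 (by positivity : (0 : ℝ) ≤ 1 / ((d : ℝ) * (d - 1)))
  refine isPPTOperation_of_bipartiteChoi (fun X => ?_) ⟨?_, ?_⟩
  · have hne : (d : ℂ) ^ 2 - 1 ≠ 0 := by exact_mod_cast hsq.ne'
    have htr : (1 - maxEntangled d).trace = (d : ℂ) ^ 2 - 1 := by
      rw [Matrix.trace_sub, trace_maxEntangled (by omega), Matrix.trace_one]
      simp [pow_two]
    rw [testAndPrepare_apply, Matrix.trace_add, Matrix.trace_smul, Matrix.trace_smul,
      Matrix.trace_smul, htr, trace_maxEntangled (by omega), sub_mul, Matrix.trace_sub]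
    simp [hne]
  · rw [bipartiteChoi_testAndPrepare]
    exact ((hF.transpose.kronecker maxEntangled_posSemidef).add
      (hF1.transpose.kronecker (one_sub_maxEntangled_posSemidef.smul c1))).submatrix _
  · rw [partialTranspose_bipartiteChoi_testAndPrepare F hd]
    exact (((h2.transpose.kronecker (one_add_flipOp_posSemidef.smul hh)).smul c2).add
      ((h1.transpose.kronecker (one_sub_flipOp_posSemidef.smul hh)).smul c3)).submatrix _

theorem testAndPrepare_eq_maxEntangled {F ρ : Op (α × β)} {d : ℕ} (htr : ρ.trace = 1)
    (h : F * ρ = ρ) : testAndPrepare F d ρ = maxEntangled d := by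
  rw [testAndPrepare_apply, sub_mul, h, one_mul, sub_self, htr]
  simp

end MeasurePrepare

/-! ### Mixtures of local isometries -/

section LocalIsometries

variable {α β α' β' : Type*}
  [Fintype α] [DecidableEq α] [Fintype β] [DecidableEq β]
  [Fintype α'] [DecidableEq α'] [Fintype β'] [DecidableEq β']

/-- The map `X ↦ (A ⊗ B) X (A ⊗ B)ᴴ`. -/
def localConj (A : Matrix α' α ℂ) (B : Matrix β' β ℂ) : Op (α × β) →ₗ[ℂ] Op (α' × β') where
  toFun X := (A ⊗ₖ B) * X * (A ⊗ₖ B).conjTranspose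
  map_add' X Y := by rw [Matrix.mul_add, Matrix.add_mul]
  map_smul' c X := by simp

omit [DecidableEq α] [DecidableEq β] [DecidableEq α'] [DecidableEq β'] [Fintype α'] [Fintype β'] in
theorem localConj_apply (A : Matrix α' α ℂ) (B : Matrix β' β ℂ) (X : Op (α × β)) :
    localConj A B X = (A ⊗ₖ B) * X * (A ⊗ₖ B).conjTranspose := rfl

omit [DecidableEq α'] [DecidableEq β'] in
theorem trace_localConj {A : Matrix α' α ℂ} {B : Matrix β' β ℂ} (hA : A.conjTranspose * A = 1)
    (hB : B.conjTranspose * B = 1) (X : Op (α × β)) : (localConj A B X).trace = X.trace := by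
  rw [localConj_apply, Matrix.trace_mul_comm, ← Matrix.mul_assoc, Matrix.conjTranspose_kronecker,
    ← Matrix.mul_kronecker_mul, hA, hB, Matrix.one_kronecker_one, one_mul]

omit [DecidableEq α'] [DecidableEq β'] [Fintype α'] [Fintype β'] in
theorem bipartiteChoi_localConj (A : Matrix α' α ℂ) (B : Matrix β' β ℂ) :
    bipartiteChoi (localConj A B) =
      proj fun x : (α × α') × (β × β') => A x.1.2 x.1.1 * B x.2.2 x.2.1 := by
  ext x y
  rw [bipartiteChoi_apply, localConj_apply, Matrix.mul_apply,
    Finset.sum_eq_single (y.1.1, y.2.1)]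
  · rw [Matrix.mul_apply, Finset.sum_eq_single (x.1.1, x.2.1)]
    · simp [proj, Matrix.vecMulVec_apply]
    · intro z _ hz
      rw [Matrix.single_apply, if_neg (by rintro ⟨h, -⟩; exact hz h.symm), mul_zero]
    · simp
  · intro z _ hz
    rw [Matrix.mul_apply, Finset.sum_eq_zero, zero_mul]
    intro w _
    rw [Matrix.single_apply, if_neg (by rintro ⟨-, h⟩; exact hz h.symm), mul_zero]
  · simp

omit [DecidableEq α'] [DecidableEq β'] in
theorem isPPT_bipartiteChoi_localConj (A : Matrix α' α ℂ) (B : Matrix β' β ℂ) :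
    IsPPT (bipartiteChoi (localConj A B)) := by
  rw [bipartiteChoi_localConj]
  refine ⟨Matrix.posSemidef_vecMulVec_self_star _, ?_⟩
  have : partialTranspose (proj fun x : (α × α') × (β × β') => A x.1.2 x.1.1 * B x.2.2 x.2.1) =
      proj fun x : (α × α') × (β × β') => A x.1.2 x.1.1 * star (B x.2.2 x.2.1) := by
    ext x y
    simp only [partialTranspose_apply, proj, Matrix.vecMulVec_apply, Pi.star_apply, star_mul',
      star_star]
    ring
  rw [this]
  exact Matrix.posSemidef_vecMulVec_self_star _

/-- The uniform mixture of local isometric conjugations. -/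
noncomputable def localMixture {F : Type*} [Fintype F] (A : F → Matrix α' α ℂ)
    (B : F → Matrix β' β ℂ) : Op (α × β) →ₗ[ℂ] Op (α' × β') :=
  (1 / (Fintype.card F : ℂ)) • ∑ f, localConj (A f) (B f)

omit [DecidableEq α'] [DecidableEq β'] in
theorem localMixture_isPPTOperation {F : Type*} [Fintype F] [Nonempty F]
    {A : F → Matrix α' α ℂ} {B : F → Matrix β' β ℂ} (hA : ∀ f, (A f).conjTranspose * A f = 1)
    (hB : ∀ f, (B f).conjTranspose * B f = 1) : IsPPTOperation (localMixture A B) := by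
  have hc : (0 : ℂ) ≤ 1 / (Fintype.card F : ℂ) := by
    rw [one_div]; exact inv_nonneg.2 (Nat.cast_nonneg _)
  have hne : (Fintype.card F : ℂ) ≠ 0 := by exact_mod_cast Fintype.card_ne_zero
  have hchoi : bipartiteChoi (localMixture A B) =
      (1 / (Fintype.card F : ℂ)) • ∑ f, bipartiteChoi (localConj (A f) (B f)) := by
    ext x y
    simp [bipartiteChoi_apply, localMixture, Matrix.sum_apply]
  have hpt : partialTranspose (bipartiteChoi (localMixture A B)) =
      (1 / (Fintype.card F : ℂ)) • ∑ f, partialTranspose (bipartiteChoi (localConj (A f) (B f))) := by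
    rw [hchoi]
    ext x y
    simp [Matrix.sum_apply]
  refine isPPTOperation_of_bipartiteChoi (fun X => ?_) ⟨?_, ?_⟩
  · simp [localMixture, Matrix.trace_sum, trace_localConj (hA _) (hB _), hne]
  · rw [hchoi]
    exact (Matrix.posSemidef_sum _ fun f _ => (isPPT_bipartiteChoi_localConj _ _).1).smul hc
  · rw [hpt]
    exact (Matrix.posSemidef_sum _ fun f _ => (isPPT_bipartiteChoi_localConj _ _).2).smul hc

omit [Fintype α'] [Fintype β'] [DecidableEq α'] [DecidableEq β'] in
theorem localConj_maxEntangled_apply {d : ℕ} (A : Matrix α' (Fin d) ℂ) (B : Matrix β' (Fin d) ℂ)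
    (x y : α' × β') : localConj A B (maxEntangled d) x y =
      1 / (d : ℂ) * ((A * B.transpose) x.1 x.2 * star ((A * B.transpose) y.1 y.2)) := by
  have hΦ : maxEntangled d = (1 / (d : ℂ)) •
      proj fun x : Fin d × Fin d => if x.1 = x.2 then (1 : ℂ) else 0 := by
    ext x y
    simp only [maxEntangled_apply, proj, Matrix.smul_apply, Matrix.vecMulVec_apply, Pi.star_apply,
      smul_eq_mul]
    by_cases h : x.1 = x.2 <;> by_cases h' : y.1 = y.2 <;> simp [h, h']
  have hv : (A ⊗ₖ B).mulVec (fun x : Fin d × Fin d => if x.1 = x.2 then (1 : ℂ) else 0) =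
      fun x => (A * B.transpose) x.1 x.2 := by
    ext x
    simp [Matrix.mulVec, dotProduct, Fintype.sum_prod_type, Matrix.mul_apply]
  rw [localConj_apply, hΦ, Matrix.mul_smul, Matrix.smul_mul, proj, Matrix.mul_vecMulVec,
    Matrix.vecMulVec_mul, ← Matrix.star_mulVec, hv]
  simp [Matrix.vecMulVec_apply]

end LocalIsometries

/-! ### Integer matrices as operators -/

section IntegerMatrices

variable {ι κ ν : Type*}

/-- A matrix of integers regarded as a complex matrix. -/
def ofInt (M : Matrix ι κ ℤ) : Matrix ι κ ℂ := M.map (Int.castRingHom ℂ)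

@[simp] theorem ofInt_apply (M : Matrix ι κ ℤ) (i : ι) (j : κ) : ofInt M i j = (M i j : ℂ) := rfl

theorem ofInt_mul [Fintype κ] (M : Matrix ι κ ℤ) (N : Matrix κ ν ℤ) :
    ofInt M * ofInt N = ofInt (M * N) := Matrix.map_mul.symm

theorem ofInt_conjTranspose (M : Matrix ι κ ℤ) :
    (ofInt M).conjTranspose = ofInt M.transpose := by
  ext i j; simp

theorem ofInt_isHermitian {M : Matrix ι ι ℤ} (h : M.transpose = M) : (ofInt M).IsHermitian := by
  rw [Matrix.IsHermitian, ofInt_conjTranspose, h]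

theorem ofInt_add (M N : Matrix ι κ ℤ) : ofInt (M + N) = ofInt M + ofInt N := by
  ext i j; simp

theorem ofInt_sub (M N : Matrix ι κ ℤ) : ofInt (M - N) = ofInt M - ofInt N := by
  ext i j; simp

theorem ofInt_one [DecidableEq ι] : ofInt (1 : Matrix ι ι ℤ) = 1 := by
  ext i j; simp [Matrix.one_apply]

theorem trace_ofInt [Fintype ι] (M : Matrix ι ι ℤ) : (ofInt M).trace = (M.trace : ℂ) := by
  simp [Matrix.trace]

/-- A symmetric integer matrix with `M² = k M`, `k > 0`, is positive semidefinite. -/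
theorem ofInt_posSemidef [Fintype ι] {M : Matrix ι ι ℤ} (h : M.transpose = M) {k : ℕ}
    (hk : 0 < k) (hM : M * M = (k : ℤ) • M) : (ofInt M).PosSemidef := by
  have h1 := Matrix.posSemidef_conjTranspose_mul_self (ofInt M)
  have hk' : (k : ℂ) ≠ 0 := by exact_mod_cast hk.ne'
  have h2 : (0 : ℂ) ≤ (k : ℂ)⁻¹ := inv_nonneg.2 (Nat.cast_nonneg k)
  have h3 := h1.smul h2
  rw [ofInt_conjTranspose, h, ofInt_mul, hM] at h3
  convert h3 using 1
  ext i j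
  simp [hk']

end IntegerMatrices

/-! ### Integer matrices on two qutrits -/

section BasicMatrices

/-- The projection onto the span of `|0k⟩, |k0⟩` with `k = 1, 2`, with integer entries. -/
def suppZ : Matrix (Fin 3 × Fin 3) (Fin 3 × Fin 3) ℤ :=
  Matrix.of fun x y => if x = y ∧ ¬ (x.1 = 0 ↔ x.2 = 0) then 1 else 0

/-- The flip `|0k⟩ ↔ |k0⟩` on the range of `suppZ`, and zero elsewhere. -/
def swapZ : Matrix (Fin 3 × Fin 3) (Fin 3 × Fin 3) ℤ :=
  Matrix.of fun x y => if x.1 = y.2 ∧ x.2 = y.1 ∧ ¬ (x.1 = 0 ↔ x.2 = 0) then 1 else 0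

/-- The partial transpose `|00⟩(⟨11| + ⟨22|) + (|11⟩ + |22⟩)⟨00|` of `swapZ`. -/
def crossZ : Matrix (Fin 3 × Fin 3) (Fin 3 × Fin 3) ℤ :=
  Matrix.of fun x y => if x.1 = x.2 ∧ y.1 = y.2 ∧ ¬ (x.1 = 0 ↔ y.1 = 0) then 1 else 0

/-- The symmetric involution fixing `|0j⟩`, `|j0⟩` and flipping `|kl⟩ ↔ |lk⟩` for `k, l ≥ 1`. -/
def involZ : Matrix (Fin 3 × Fin 3) (Fin 3 × Fin 3) ℤ :=
  Matrix.of fun x y => if x.1 = 0 ∨ x.2 = 0 then (if x = y then 1 else 0) else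
    if x.1 = y.2 ∧ x.2 = y.1 then 1 else 0

/-- The partial transpose of `involZ`. -/
def involPTZ : Matrix (Fin 3 × Fin 3) (Fin 3 × Fin 3) ℤ :=
  Matrix.of fun x y => involZ (x.1, y.2) (y.1, x.2)

theorem suppZ_mul_suppZ : suppZ * suppZ = suppZ := by decide +kernel
theorem swapZ_mul_swapZ : swapZ * swapZ = suppZ := by decide +kernel
theorem suppZ_mul_swapZ : suppZ * swapZ = swapZ := by decide +kernel
theorem swapZ_mul_suppZ : swapZ * suppZ = swapZ := by decide +kernel
theorem suppZ_mul_crossZ : suppZ * crossZ = 0 := by decide +kernel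
theorem crossZ_mul_suppZ : crossZ * suppZ = 0 := by decide +kernel
theorem crossZ_cube : crossZ * crossZ * crossZ = (2 : ℤ) • crossZ := by decide +kernel
theorem involZ_mul_involZ : involZ * involZ = 1 := by decide +kernel

end BasicMatrices

/-! ### Operators attached to a single copy of the state -/

section SingleCopy

/-- The projection onto the span of `|0k⟩, |k0⟩` with `k = 1, 2`. -/
def suppOp : Op (Fin 3 × Fin 3) := ofInt suppZ

/-- The flip on the range of `suppOp`, zero on its complement. -/
def swapOp : Op (Fin 3 × Fin 3) := ofInt swapZ

/-- The partial transpose of `swapOp`. -/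
def crossOp : Op (Fin 3 × Fin 3) := ofInt crossZ

theorem suppOp_mul_suppOp : suppOp * suppOp = suppOp := by
  rw [suppOp, ofInt_mul, suppZ_mul_suppZ]

theorem swapOp_mul_swapOp : swapOp * swapOp = suppOp := by
  rw [swapOp, ofInt_mul, swapZ_mul_swapZ, suppOp]

theorem suppOp_mul_swapOp : suppOp * swapOp = swapOp := by
  rw [swapOp, suppOp, ofInt_mul, suppZ_mul_swapZ]

theorem swapOp_mul_suppOp : swapOp * suppOp = swapOp := by
  rw [swapOp, suppOp, ofInt_mul, swapZ_mul_suppZ]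

theorem suppOp_mul_crossOp : suppOp * crossOp = 0 := by
  rw [crossOp, suppOp, ofInt_mul, suppZ_mul_crossZ]; ext; simp

theorem crossOp_mul_suppOp : crossOp * suppOp = 0 := by
  rw [crossOp, suppOp, ofInt_mul, crossZ_mul_suppZ]; ext; simp

theorem crossOp_cube : crossOp * crossOp * crossOp = (2 : ℂ) • crossOp := by
  rw [crossOp, ofInt_mul, ofInt_mul, crossZ_cube]
  ext i j
  simp only [ofInt_apply, Matrix.smul_apply, smul_eq_mul, Int.cast_mul, Int.cast_ofNat]

theorem suppOp_isHermitian : suppOp.IsHermitian := ofInt_isHermitian (by decide +kernel)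
theorem crossOp_isHermitian : crossOp.IsHermitian := ofInt_isHermitian (by decide +kernel)

theorem suppOp_posSemidef : suppOp.PosSemidef :=
  posSemidef_of_idempotent suppOp_isHermitian suppOp_mul_suppOp

theorem partialTranspose_ofInt {M N : Matrix (Fin 3 × Fin 3) (Fin 3 × Fin 3) ℤ}
    (h : (Matrix.of fun x y => M (x.1, y.2) (y.1, x.2)) = N) :
    partialTranspose (ofInt M) = ofInt N := by
  rw [← h]
  rfl

theorem partialTranspose_suppOp : partialTranspose suppOp = suppOp :=
  partialTranspose_ofInt (by decide +kernel)

theorem partialTranspose_swapOp : partialTranspose swapOp = crossOp :=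
  partialTranspose_ofInt (by decide +kernel)

theorem suppOp_add_swapOp_posSemidef : (suppOp + swapOp).PosSemidef := by
  rw [suppOp, swapOp, ← ofInt_add]
  exact ofInt_posSemidef (k := 2) (by decide +kernel) (by norm_num) (by decide +kernel)

theorem suppOp_sub_swapOp_posSemidef : (suppOp - swapOp).PosSemidef := by
  rw [suppOp, swapOp, ← ofInt_sub]
  exact ofInt_posSemidef (k := 2) (by decide +kernel) (by norm_num) (by decide +kernel)

/-- Amplitudes of the unnormalized antisymmetric vectors `|0,k+1⟩ - |k+1,0⟩`. -/
def antisymZ (k : Fin 2) (x : Fin 3 × Fin 3) : ℤ :=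
  if x = (0, k.succ) then 1 else if x = (k.succ, 0) then -1 else 0

theorem antisymZ_eq_ket (k : Fin 2) :
    (fun x => (antisymZ k x : ℂ)) = ket 0 k.succ - ket k.succ 0 := by
  ext x
  have hne : ((0 : Fin 3), k.succ) ≠ (k.succ, 0) := by
    intro h; exact Fin.succ_ne_zero k (Prod.mk.inj h).1.symm
  simp only [antisymZ, ket, Pi.sub_apply, Pi.single_apply]
  by_cases h1 : x = (0, k.succ)
  · simp [h1, hne]
  · by_cases h2 : x = (k.succ, 0) <;> simp [h1, h2, hne.symm]

theorem proj_smul_antisymZ (k : Fin 2) (x y : Fin 3 × Fin 3) :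
    proj (((1 / √2 : ℝ) : ℂ) • (ket 0 k.succ - ket k.succ 0)) x y =
      1 / 2 * ((antisymZ k x : ℂ) * antisymZ k y) := by
  have h2 : ((1 / √2 : ℝ) : ℂ) * ((1 / √2 : ℝ) : ℂ) = 1 / 2 := by
    rw [← Complex.ofReal_mul, div_mul_div_comm, Real.mul_self_sqrt (by norm_num)]
    norm_num
  rw [← antisymZ_eq_ket]
  simp only [proj, Matrix.vecMulVec_apply, Pi.smul_apply, Pi.star_apply, smul_eq_mul, star_mul']
  rw [← h2]
  simp only [RCLike.star_def, Complex.conj_ofReal, map_intCast]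
  ring

theorem rhoV_apply (x y : Fin 3 × Fin 3) :
    rhoV x y = 1 / 4 * ∑ k : Fin 2, (antisymZ k x : ℂ) * antisymZ k y := by
  have h1 := proj_smul_antisymZ 0 x y
  have h2 := proj_smul_antisymZ 1 x y
  have e1 : v1 = ((1 / √2 : ℝ) : ℂ) •
      (ket 0 (Fin.succ (0 : Fin 2)) - ket (Fin.succ (0 : Fin 2)) 0) := rfl
  have e2 : v2 = ((1 / √2 : ℝ) : ℂ) •
      (ket 0 (Fin.succ (1 : Fin 2)) - ket (Fin.succ (1 : Fin 2)) 0) := rfl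
  rw [← e1] at h1
  rw [← e2] at h2
  rw [rhoV, Matrix.smul_apply, Matrix.add_apply, h1, h2, Fin.sum_univ_two, smul_eq_mul]
  ring

theorem rhoV_eq : rhoV = (1 / 4 : ℂ) • (suppOp - swapOp) := by
  have h : ∀ x y, ∑ k : Fin 2, antisymZ k x * antisymZ k y = suppZ x y - swapZ x y := by
    decide +kernel
  ext x y
  rw [rhoV_apply]
  simp only [Matrix.smul_apply, Matrix.sub_apply, suppOp, swapOp, ofInt_apply, smul_eq_mul]
  rw [← Int.cast_sub, ← h]
  push_cast
  rfl

theorem suppOp_sub_swapOp_mul_self :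
    (suppOp - swapOp) * (suppOp - swapOp) = (2 : ℂ) • (suppOp - swapOp) := by
  rw [mul_sub, sub_mul, sub_mul, suppOp_mul_suppOp, swapOp_mul_swapOp, suppOp_mul_swapOp,
    swapOp_mul_suppOp, two_smul]
  abel

theorem rhoV_posSemidef : rhoV.PosSemidef := by
  rw [rhoV_eq]
  exact suppOp_sub_swapOp_posSemidef.smul (by norm_num [Complex.le_def])

theorem rhoV_mul_self : rhoV * rhoV = (1 / 2 : ℂ) • rhoV := by
  rw [rhoV_eq, Matrix.smul_mul, Matrix.mul_smul, suppOp_sub_swapOp_mul_self]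
  simp only [smul_smul]
  norm_num

theorem trace_suppOp : suppOp.trace = 4 := by
  rw [suppOp, trace_ofInt, (by decide +kernel : suppZ.trace = 4)]; norm_num

theorem trace_swapOp : swapOp.trace = 0 := by
  rw [swapOp, trace_ofInt, (by decide +kernel : swapZ.trace = 0)]; norm_num

theorem trace_crossOp_sq : (crossOp * crossOp).trace = 4 := by
  rw [crossOp, ofInt_mul, trace_ofInt, (by decide +kernel : (crossZ * crossZ).trace = 4)]; norm_num

theorem trace_rhoV : rhoV.trace = 1 := by
  rw [rhoV_eq, Matrix.trace_smul, Matrix.trace_sub, trace_suppOp, trace_swapOp]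
  norm_num

theorem rhoV_mul_suppOp : rhoV * suppOp = rhoV := by
  rw [rhoV_eq, Matrix.smul_mul, sub_mul, suppOp_mul_suppOp, swapOp_mul_suppOp]

theorem sqrt_two_mul_sqrt_two : ((√2 : ℝ) : ℂ) * ((√2 : ℝ) : ℂ) = 2 := by
  rw [← Complex.ofReal_mul, Real.mul_self_sqrt (by norm_num)]
  norm_num

/-- The classically correlated state `suppOp / 4`, which is optimal for the PPT relative entropy
of entanglement of `rhoV`. -/
noncomputable def sepState : Op (Fin 3 × Fin 3) := (1 / 4 : ℂ) • suppOp

theorem sepState_isPPT : IsPPT sepState := by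
  have h : sepState.PosSemidef := suppOp_posSemidef.smul (by norm_num [Complex.le_def])
  refine ⟨h, ?_⟩
  rwa [sepState, partialTranspose_smul, partialTranspose_suppOp]

theorem trace_sepState : sepState.trace = 1 := by
  rw [sepState, Matrix.trace_smul, trace_suppOp]
  norm_num

theorem sepState_mul_self : sepState * sepState = (1 / 4 : ℂ) • sepState := by
  rw [sepState, Matrix.smul_mul, Matrix.mul_smul, suppOp_mul_suppOp]

theorem rhoV_mul_sepState : rhoV * sepState = (1 / 4 : ℂ) • rhoV := by
  rw [sepState, Matrix.mul_smul, rhoV_mul_suppOp]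

/-- The modulus of `rhoV^Γ`. -/
noncomputable def absRhoVPT : Op (Fin 3 × Fin 3) :=
  (1 / 4 : ℂ) • (suppOp + (1 / (√2 : ℝ) : ℂ) • (crossOp * crossOp))

theorem partialTranspose_rhoV : partialTranspose rhoV = (1 / 4 : ℂ) • (suppOp - crossOp) := by
  rw [rhoV_eq, partialTranspose_smul, partialTranspose_sub, partialTranspose_suppOp,
    partialTranspose_swapOp]

theorem absRhoVPT_posSemidef : absRhoVPT.PosSemidef := by
  have h1 : (0 : ℂ) ≤ 1 / (√2 : ℝ) := by
    simp
  have h2 := Matrix.posSemidef_conjTranspose_mul_self crossOp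
  rw [crossOp_isHermitian.eq] at h2
  exact (suppOp_posSemidef.add (h2.smul h1)).smul (by norm_num [Complex.le_def])

theorem absRhoVPT_mul_self :
    absRhoVPT * absRhoVPT = partialTranspose rhoV * partialTranspose rhoV := by
  have h1 : suppOp * (crossOp * crossOp) = 0 := by
    rw [← mul_assoc, suppOp_mul_crossOp, zero_mul]
  have h2 : crossOp * crossOp * suppOp = 0 := by
    rw [mul_assoc, crossOp_mul_suppOp, mul_zero]
  have h3 : crossOp * crossOp * (crossOp * crossOp) = (2 : ℂ) • (crossOp * crossOp) := by
    rw [← mul_assoc, crossOp_cube, Matrix.smul_mul]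
  have h4 : (1 / (√2 : ℝ) : ℂ) * (1 / (√2 : ℝ)) * 2 = 1 := by
    rw [div_mul_div_comm, sqrt_two_mul_sqrt_two]
    norm_num
  rw [partialTranspose_rhoV, absRhoVPT]
  simp only [Matrix.smul_mul, Matrix.mul_smul, mul_add, add_mul, mul_sub, sub_mul, h1, h2, h3,
    suppOp_mul_suppOp, suppOp_mul_crossOp, crossOp_mul_suppOp]
  ext i j
  simp only [Matrix.add_apply, Matrix.sub_apply, Matrix.smul_apply, Matrix.zero_apply, smul_eq_mul]
  linear_combination (1 / 16 * (crossOp * crossOp) i j) * h4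

theorem trace_absRhoVPT : absRhoVPT.trace = ((1 + 1 / √2 : ℝ) : ℂ) := by
  rw [absRhoVPT, Matrix.trace_smul, Matrix.trace_add, Matrix.trace_smul, trace_suppOp,
    trace_crossOp_sq]
  simp only [smul_eq_mul]
  push_cast
  ring

/-- The involution `U` whose partial transpose dominates `±2 P^Γ`, `P` the support projection of
`rhoV`. -/
def involOp : Op (Fin 3 × Fin 3) := ofInt involZ

theorem involOp_isHermitian : involOp.IsHermitian := ofInt_isHermitian (by decide +kernel)

theorem involOp_mul_self : involOp * involOp = 1 := by
  rw [involOp, ofInt_mul, involZ_mul_involZ, ofInt_one]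

theorem partialTranspose_involOp : partialTranspose involOp = ofInt involPTZ :=
  partialTranspose_ofInt rfl

/-- The left side is the projection onto `|00⟩ + |11⟩ + |22⟩`, up to a factor. -/
theorem involOp_sub_posSemidef :
    (partialTranspose involOp - partialTranspose (suppOp - swapOp)).PosSemidef := by
  rw [partialTranspose_involOp, partialTranspose_sub, partialTranspose_suppOp,
    partialTranspose_swapOp, suppOp, crossOp, ← ofInt_sub, ← ofInt_sub]
  exact ofInt_posSemidef (k := 3) (by decide +kernel) (by norm_num) (by decide +kernel)

theorem involOp_add_posSemidef :
    (partialTranspose involOp + partialTranspose (suppOp - swapOp)).PosSemidef := by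
  rw [partialTranspose_involOp, partialTranspose_sub, partialTranspose_suppOp,
    partialTranspose_swapOp, suppOp, crossOp, ← ofInt_sub, ← ofInt_add]
  have h : involPTZ + (suppZ - crossZ) = (suppZ + suppZ) + (involPTZ - suppZ - crossZ) := by
    abel
  -- The last summand is a multiple of the projection onto `|00⟩ - |11⟩ - |22⟩`.
  rw [h, ofInt_add, ofInt_add]
  exact (suppOp_posSemidef.add suppOp_posSemidef).add
    (ofInt_posSemidef (k := 3) (by decide +kernel) (by norm_num) (by decide +kernel))

/-- The test `c suppOp - (√2 - 1) swapOp`, `c = 2 - √2`, accepting `rhoV` with certainty. -/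
noncomputable def testOp : Op (Fin 3 × Fin 3) :=
  ((2 - √2 : ℝ) : ℂ) • suppOp - ((√2 - 1 : ℝ) : ℂ) • swapOp

theorem sqrt_two_bounds : 1 < √2 ∧ √2 < 3 / 2 := by
  constructor
  · rw [Real.lt_sqrt] <;> norm_num
  · rw [Real.sqrt_lt'] <;> norm_num

/-- The test dominates the support projection `2 ρ`. -/
theorem testOp_sub_posSemidef : (testOp - (2 : ℂ) • rhoV).PosSemidef := by
  have : testOp - (2 : ℂ) • rhoV = ((3 / 2 - √2 : ℝ) : ℂ) • (suppOp + swapOp) := by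
    rw [rhoV_eq, testOp]
    ext i j
    simp
    ring
  rw [this]
  exact suppOp_add_swapOp_posSemidef.smul
    (Complex.zero_le_real.2 (by linarith [sqrt_two_bounds.2]))

theorem two_smul_rhoV_posSemidef : ((2 : ℂ) • rhoV).PosSemidef :=
  rhoV_posSemidef.smul (by norm_num [Complex.le_def])

theorem testOp_posSemidef : testOp.PosSemidef := by
  simpa using testOp_sub_posSemidef.add two_smul_rhoV_posSemidef

theorem one_sub_testOp_posSemidef : (1 - testOp).PosSemidef := by
  have : 1 - testOp = (1 - suppOp) + ((√2 - 1 : ℝ) : ℂ) • (suppOp + swapOp) := by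
    rw [testOp]
    ext i j
    simp
    ring
  rw [this]
  refine Matrix.PosSemidef.add (one_sub_posSemidef_of_cube suppOp_isHermitian ?_)
    (suppOp_add_swapOp_posSemidef.smul (Complex.zero_le_real.2 (by linarith [sqrt_two_bounds.1])))
  rw [suppOp_mul_suppOp, suppOp_mul_suppOp]

theorem testOp_mul_rhoV : testOp * rhoV = rhoV := by
  rw [testOp, rhoV_eq]
  simp only [Matrix.mul_smul, sub_mul, mul_sub, Matrix.smul_mul, suppOp_mul_suppOp,
    suppOp_mul_swapOp, swapOp_mul_suppOp, swapOp_mul_swapOp]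
  ext i j
  simp
  ring

/-- The operator `V = suppOp - crossOp / √2`, with spectrum `{-1, 0, 1}`. -/
noncomputable def ternaryOp : Op (Fin 3 × Fin 3) :=
  suppOp - (1 / (√2 : ℝ) : ℂ) • crossOp

theorem partialTranspose_testOp :
    partialTranspose testOp = ((2 - √2 : ℝ) : ℂ) • ternaryOp := by
  rw [testOp, partialTranspose_sub, partialTranspose_smul, partialTranspose_smul,
    partialTranspose_suppOp, partialTranspose_swapOp, ternaryOp, smul_sub, smul_smul]
  congr 2
  have h : (2 - √2) * (1 / √2) = √2 - 1 := by
    have h0 : √2 ≠ 0 := by positivity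
    field_simp
    nlinarith [Real.mul_self_sqrt (show (0 : ℝ) ≤ 2 by norm_num)]
  rw [← h]
  push_cast
  rfl

theorem ternaryOp_isHermitian : ternaryOp.IsHermitian := by
  refine suppOp_isHermitian.sub ?_
  rw [Matrix.IsHermitian, Matrix.conjTranspose_smul, crossOp_isHermitian.eq]
  simp

theorem ternaryOp_cube : ternaryOp * ternaryOp * ternaryOp = ternaryOp := by
  have h4 : (1 / (√2 : ℝ) : ℂ) * (1 / (√2 : ℝ)) * 2 = 1 := by
    rw [div_mul_div_comm, sqrt_two_mul_sqrt_two]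
    norm_num
  have hsq : ternaryOp * ternaryOp =
      suppOp + ((1 / (√2 : ℝ) : ℂ) * (1 / (√2 : ℝ))) • (crossOp * crossOp) := by
    rw [ternaryOp]
    simp only [Matrix.smul_mul, Matrix.mul_smul, mul_sub, sub_mul, suppOp_mul_suppOp,
      suppOp_mul_crossOp, crossOp_mul_suppOp, smul_smul]
    simp
  rw [hsq, ternaryOp]
  have h2 : crossOp * crossOp * suppOp = 0 := by
    rw [mul_assoc, crossOp_mul_suppOp, mul_zero]
  simp only [Matrix.smul_mul, Matrix.mul_smul, mul_sub, add_mul, suppOp_mul_suppOp,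
    suppOp_mul_crossOp, h2, crossOp_cube, smul_smul]
  simp only [smul_zero, add_zero, zero_add]
  rw [show (1 / (√2 : ℝ) : ℂ) * ((1 / (√2 : ℝ) : ℂ) * (1 / (√2 : ℝ)) * 2) = 1 / (√2 : ℝ) by
    rw [h4, mul_one]]

end SingleCopy

/-! ### Relative entropy bounds for many copies -/

section ManyCopies

variable {n : ℕ}

theorem tensorPower_rhoV_posSemidef : (tensorPower rhoV n).PosSemidef :=
  tensorPower_posSemidef rhoV_posSemidef

theorem trace_tensorPower_rhoV : (tensorPower rhoV n).trace = 1 := by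
  rw [trace_tensorPower, trace_rhoV, one_pow]

theorem tensorPower_rhoV_mul_self : tensorPower rhoV n * tensorPower rhoV n =
    (((1 / 2) ^ n : ℝ) : ℂ) • tensorPower rhoV n := by
  rw [← tensorPower_mul, rhoV_mul_self, tensorPower_smul]
  push_cast
  rfl

/-- The support projection `(2 ρ)^{⊗ n}` has overlap at most `2^{-n}` with PPT states. -/
theorem re_trace_support_mul_le {ω : Op ((Fin n → Fin 3) × (Fin n → Fin 3))} (hω : IsPPT ω) :
    (tensorPower ((2 : ℂ) • rhoV) n * ω).trace.re ≤ (1 / 2) ^ n * ω.trace.re := by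
  have hh : (0 : ℂ) ≤ 1 / 2 := by norm_num [Complex.le_def]
  have e : (2 : ℂ) • rhoV = (1 / 2 : ℂ) • (suppOp - swapOp) := by
    rw [rhoV_eq, smul_smul]; norm_num
  have h1 : (tensorPower ((1 / 2 : ℂ) • partialTranspose involOp) n -
      tensorPower (partialTranspose ((2 : ℂ) • rhoV)) n).PosSemidef := by
    rw [e, partialTranspose_smul]
    refine tensorPower_sub_posSemidef ?_ ?_
    · rw [← smul_sub]; exact involOp_sub_posSemidef.smul hh
    · rw [← smul_add]; exact involOp_add_posSemidef.smul hh
  have h2 := re_trace_mul_mono_left h1 hω.2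
  rw [← partialTranspose_tensorPower, trace_partialTranspose_mul, partialTranspose_partialTranspose,
    ← partialTranspose_smul, ← partialTranspose_tensorPower, trace_partialTranspose_mul,
    partialTranspose_partialTranspose, tensorPower_smul _ involOp] at h2
  have h3 : (1 - tensorPower involOp n).PosSemidef := by
    refine one_sub_posSemidef_of_cube (tensorPower_isHermitian involOp_isHermitian) ?_
    rw [← tensorPower_mul, involOp_mul_self, tensorPower_one, one_mul]
  have h4 := re_trace_mul_mono_left h3 hω.1
  rw [one_mul] at h4
  have h5 : ((1 / 2 : ℂ) ^ n) = (((1 / 2) ^ n : ℝ) : ℂ) := by push_cast; rfl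
  rw [h5, Matrix.smul_mul, Matrix.trace_smul, smul_eq_mul, Complex.re_ofReal_mul] at h2
  exact h2.trans (mul_le_mul_of_nonneg_left h4 (by positivity))

/-- `ρ^{⊗ n}` is `2^{-n}` times its support projection. -/
theorem tensorPower_two_smul_rhoV :
    tensorPower rhoV n = (((1 / 2) ^ n : ℝ) : ℂ) • tensorPower ((2 : ℂ) • rhoV) n := by
  rw [tensorPower_smul, smul_smul]
  push_cast
  rw [← mul_pow]
  norm_num

theorem logb_half_pow (n : ℕ) : Real.logb 2 ((1 / 2 : ℝ) ^ n) = -n := by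
  rw [Real.logb_pow, one_div, Real.logb_inv, Real.logb_self_eq_one (by norm_num)]
  ring

theorem logb_quarter_pow (n : ℕ) : Real.logb 2 ((1 / 4 : ℝ) ^ n) = -(2 * n) := by
  have : (1 / 4 : ℝ) ^ n = (1 / 2) ^ (2 * n) := by
    rw [pow_mul]; norm_num
  rw [this, logb_half_pow]
  push_cast
  ring

/-- The infimum is attained at the state `sepState^{⊗ n}`. -/
theorem reePPT_tensorPower_rhoV (n : ℕ) : reePPT (tensorPower rhoV n) = ((n : ℝ) : EReal) := by
  apply le_antisymm
  · have hmem : tensorPower sepState n ∈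
        {σ : Op ((Fin n → Fin 3) × (Fin n → Fin 3)) | IsPPT σ ∧ σ.trace = 1} :=
      ⟨⟨tensorPower_posSemidef sepState_isPPT.1, tensorPower_posSemidef sepState_isPPT.2⟩,
        by rw [trace_tensorPower, trace_sepState, one_pow]⟩
    refine (iInf₂_le _ hmem).trans (le_of_eq ?_)
    rw [relEntropy_of_sq (p := (1 / 2) ^ n) (q := (1 / 4) ^ n) tensorPower_rhoV_posSemidef
      hmem.1.1 trace_tensorPower_rhoV (by positivity) (by positivity) tensorPower_rhoV_mul_self ?_ ?_,
      logb_half_pow, logb_quarter_pow]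
    · congr 1; ring
    · rw [← tensorPower_mul, sepState_mul_self, tensorPower_smul]
      push_cast
      rfl
    · rw [← tensorPower_mul, rhoV_mul_sepState, tensorPower_smul]
      push_cast
      rfl
  · refine le_iInf₂ fun σ hσ => ?_
    have h1 := re_trace_support_mul_le hσ.1
    rw [hσ.2, Complex.one_re, mul_one] at h1
    have h2 : (tensorPower rhoV n * σ).trace.re ≤ (1 / 2) ^ n * (1 / 2) ^ n := by
      rw [tensorPower_two_smul_rhoV, Matrix.smul_mul, Matrix.trace_smul, smul_eq_mul,
        Complex.re_ofReal_mul]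
      exact mul_le_mul_of_nonneg_left h1 (by positivity)
    have h3 := neg_logb_le_relEntropy tensorPower_rhoV_posSemidef hσ.1.1 trace_tensorPower_rhoV
      (by positivity) tensorPower_rhoV_mul_self (by positivity) h2
    rwa [logb_half_pow, neg_neg] at h3

theorem two_sub_sqrt_two_mul : (2 - √2) * (1 + 1 / √2) = 1 := by
  have h0 : √2 ≠ 0 := by positivity
  field_simp
  nlinarith [Real.mul_self_sqrt (show (0 : ℝ) ≤ 2 by norm_num)]

theorem two_sub_sqrt_two_pos : 0 < 2 - √2 := by linarith [sqrt_two_bounds.2]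

theorem traceNorm_partialTranspose_rhoV {a : ℝ} (ha : 0 ≤ a) :
    traceNorm (partialTranspose (tensorPower ((a : ℂ) • rhoV) n)) = (a * (1 + 1 / √2)) ^ n := by
  have hc : (0 : ℂ) ≤ (a : ℂ) := Complex.zero_le_real.2 ha
  rw [traceNorm, absOp_eq_of_sq (Y := tensorPower ((a : ℂ) • absRhoVPT) n)
    (tensorPower_posSemidef (absRhoVPT_posSemidef.smul hc)), trace_tensorPower, Matrix.trace_smul,
    trace_absRhoVPT, smul_eq_mul, ← Complex.ofReal_mul, ← Complex.ofReal_pow, Complex.ofReal_re]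
  have hH : (partialTranspose (tensorPower ((a : ℂ) • rhoV) n)).IsHermitian :=
    partialTranspose_isHermitian (tensorPower_isHermitian (rhoV_posSemidef.smul hc).isHermitian)
  rw [hH.eq, partialTranspose_tensorPower, ← tensorPower_mul, ← tensorPower_mul,
    partialTranspose_smul, Matrix.smul_mul, Matrix.mul_smul, absRhoVPT_mul_self, Matrix.smul_mul,
    Matrix.mul_smul]

theorem tensorPower_testOp_sub_posSemidef :
    (tensorPower testOp n - tensorPower ((2 : ℂ) • rhoV) n).PosSemidef :=
  tensorPower_mono two_smul_rhoV_posSemidef testOp_sub_posSemidef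

theorem partialTranspose_tensorPower_testOp :
    partialTranspose (tensorPower testOp n) =
      (((2 - √2) ^ n : ℝ) : ℂ) • tensorPower ternaryOp n := by
  rw [partialTranspose_tensorPower, partialTranspose_testOp, tensorPower_smul, Complex.ofReal_pow]

theorem tensorPower_ternaryOp_cube :
    tensorPower ternaryOp n * tensorPower ternaryOp n * tensorPower ternaryOp n =
      tensorPower ternaryOp n := by
  rw [← tensorPower_mul, ← tensorPower_mul, ternaryOp_cube]

theorem one_sub_tensorPower_ternaryOp_posSemidef : (1 - tensorPower ternaryOp n).PosSemidef :=
  one_sub_posSemidef_of_cube (tensorPower_isHermitian ternaryOp_isHermitian)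
    tensorPower_ternaryOp_cube

theorem one_add_tensorPower_ternaryOp_posSemidef : (1 + tensorPower ternaryOp n).PosSemidef :=
  one_add_posSemidef_of_cube (tensorPower_isHermitian ternaryOp_isHermitian)
    tensorPower_ternaryOp_cube

/-- The bound is attained at `σ = (c ρ)^{⊗ n}` with `c = 2 - √2`; the lower bound tests `σ` with `testOp^{⊗ n}`. -/
theorem rainsBound_tensorPower_rhoV (n : ℕ) :
    rainsBound (tensorPower rhoV n) = ((n * Real.logb 2 (1 + 1 / √2) : ℝ) : EReal) := by
  have hcpos := two_sub_sqrt_two_pos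
  have hlog : Real.logb 2 ((2 - √2) ^ n) = -(n * Real.logb 2 (1 + 1 / √2)) := by
    rw [Real.logb_pow, eq_inv_of_mul_eq_one_left two_sub_sqrt_two_mul, Real.logb_inv]
    ring
  apply le_antisymm
  · have hmem : tensorPower (((2 - √2 : ℝ) : ℂ) • rhoV) n ∈
        {σ : Op ((Fin n → Fin 3) × (Fin n → Fin 3)) |
          σ.PosSemidef ∧ traceNorm (partialTranspose σ) ≤ 1} := by
      refine ⟨tensorPower_posSemidef (rhoV_posSemidef.smul (Complex.zero_le_real.2 hcpos.le)), ?_⟩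
      rw [traceNorm_partialTranspose_rhoV hcpos.le, two_sub_sqrt_two_mul, one_pow]
    have h2 : rhoV * (((2 - √2 : ℝ) : ℂ) • rhoV) =
        (((2 - √2) * (1 / 2) : ℝ) : ℂ) • rhoV := by
      rw [Matrix.mul_smul, rhoV_mul_self, smul_smul]
      push_cast
      rfl
    refine (iInf₂_le _ hmem).trans (le_of_eq ?_)
    rw [relEntropy_of_sq (p := (1 / 2) ^ n) (q := ((2 - √2) * (1 / 2)) ^ n)
      tensorPower_rhoV_posSemidef hmem.1 trace_tensorPower_rhoV (by positivity) (by positivity)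
      tensorPower_rhoV_mul_self ?_ ?_, mul_pow, Real.logb_mul (by positivity) (by positivity), hlog]
    · congr 1; ring
    · rw [← tensorPower_mul, Matrix.smul_mul, h2, smul_comm, tensorPower_smul, Complex.ofReal_pow]
    · rw [← tensorPower_mul, h2, tensorPower_smul, Complex.ofReal_pow]
  · refine le_iInf₂ fun σ hσ => ?_
    have hc : (0 : ℂ) ≤ (((2 - √2) ^ n : ℝ) : ℂ) := Complex.zero_le_real.2 (by positivity)
    have h1 := re_trace_mul_mono_left (tensorPower_testOp_sub_posSemidef (n := n)) hσ.1
    have h2 := re_trace_mul_le_traceNorm (G := partialTranspose (tensorPower testOp n))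
      (X := partialTranspose σ) (t := (2 - √2) ^ n)
      (by
        rw [partialTranspose_tensorPower_testOp, ← smul_sub]
        exact one_sub_tensorPower_ternaryOp_posSemidef.smul hc)
      (by
        rw [partialTranspose_tensorPower_testOp, ← smul_add]
        exact one_add_tensorPower_ternaryOp_posSemidef.smul hc)
      (partialTranspose_isHermitian hσ.1.isHermitian)
    rw [trace_partialTranspose_mul, partialTranspose_partialTranspose] at h2
    have h3 : (tensorPower rhoV n * σ).trace.re ≤ (1 / 2) ^ n * (2 - √2) ^ n := by
      rw [tensorPower_two_smul_rhoV, Matrix.smul_mul, Matrix.trace_smul, smul_eq_mul,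
        Complex.re_ofReal_mul]
      refine mul_le_mul_of_nonneg_left (h1.trans (h2.trans ?_)) (by positivity)
      exact mul_le_of_le_one_right (by positivity) hσ.2
    have h4 := neg_logb_le_relEntropy tensorPower_rhoV_posSemidef hσ.1 trace_tensorPower_rhoV
      (by positivity) tensorPower_rhoV_mul_self (by positivity) h3
    rwa [hlog, neg_neg] at h4

/-- If `f n` is exactly `n L`, then so is its regularization. -/
theorem tendsto_regularization {f : ℕ → EReal} {L : ℝ} (h : ∀ n : ℕ, f n = ((n * L : ℝ) : EReal)) :
    Tendsto (fun n : ℕ => ((1 / (n : ℝ) : ℝ) : EReal) * f n) atTop (𝓝 (L : EReal)) := by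
  refine tendsto_const_nhds.congr' ?_
  filter_upwards [eventually_ne_atTop 0] with n hn
  have hn' : (n : ℝ) ≠ 0 := by exact_mod_cast hn
  rw [h, ← EReal.coe_mul]
  congr 1
  field_simp

end ManyCopies

/-! ### Distillable entanglement -/

section Distillation

/-- The `n`-copy test turns `ρ^{⊗ n}` into `Φ(d)` without error as long as `d (2 - √2)^n ≤ 1`. -/
theorem conversionError_maxEntangled_eq_zero {n d : ℕ} (hd : 2 ≤ d) (h : d * (2 - √2) ^ n ≤ 1) :
    conversionError (tensorPower rhoV n) (maxEntangled d) = 0 := by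
  have hcpos := two_sub_sqrt_two_pos
  set V := tensorPower ternaryOp n with hV
  have e : (d : ℂ) • partialTranspose (tensorPower testOp n) =
      ((d * (2 - √2) ^ n : ℝ) : ℂ) • V := by
    rw [partialTranspose_tensorPower_testOp, smul_smul]
    push_cast
    rfl
  set s : ℝ := d * (2 - √2) ^ n with hs
  have hs0 : (0 : ℂ) ≤ (s : ℂ) := Complex.zero_le_real.2 (by positivity)
  have hs1 : (0 : ℂ) ≤ ((1 - s : ℝ) : ℂ) := Complex.zero_le_real.2 (by linarith)
  refine conversionError_eq_zero (testAndPrepare_isPPTOperation hd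
    (tensorPower_posSemidef testOp_posSemidef) ?_ ?_ ?_)
    (testAndPrepare_eq_maxEntangled trace_tensorPower_rhoV ?_)
  · have := tensorPower_mono (n := n) testOp_posSemidef one_sub_testOp_posSemidef
    rwa [tensorPower_one] at this
  · rw [e]
    have : 1 - (s : ℂ) • V = ((1 - s : ℝ) : ℂ) • 1 + (s : ℂ) • (1 - V) := by
      ext i j; simp; ring
    rw [this]
    exact (Matrix.PosSemidef.one.smul hs1).add (one_sub_tensorPower_ternaryOp_posSemidef.smul hs0)
  · rw [e]
    have : 1 + (s : ℂ) • V = ((1 - s : ℝ) : ℂ) • 1 + (s : ℂ) • (1 + V) := by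
      ext i j; simp; ring
    rw [this]
    exact (Matrix.PosSemidef.one.smul hs1).add (one_add_tensorPower_ternaryOp_posSemidef.smul hs0)
  · rw [← tensorPower_mul, testOp_mul_rhoV]

theorem eventually_lt_two_rpow {δ : ℝ} (hδ : 0 < δ) (C : ℝ) :
    ∀ᶠ n : ℕ in atTop, C < (2 : ℝ) ^ (δ * n) := by
  have h1 : (1 : ℝ) < 2 ^ δ := Real.one_lt_rpow (by norm_num) hδ
  filter_upwards [(tendsto_pow_atTop_atTop_of_one_lt h1).eventually_gt_atTop C] with n hn
  rwa [Real.rpow_mul (by norm_num), Real.rpow_natCast]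

theorem one_add_inv_sqrt_two_pos : 0 < 1 + 1 / √2 := by positivity

theorem two_rpow_logb_mul (n : ℕ) :
    (2 : ℝ) ^ (Real.logb 2 (1 + 1 / √2) * n) = (1 + 1 / √2) ^ n := by
  rw [Real.rpow_mul (by norm_num), Real.rpow_logb (by norm_num) (by norm_num)
    one_add_inv_sqrt_two_pos, Real.rpow_natCast]

/-- For `n ≥ 2` the target dimension is at least two, so the exact protocol applies. -/
theorem logb_mem_distillable_rates :
    Tendsto (fun n : ℕ => conversionError (tensorPower rhoV n)
      (maxEntangled ⌊(2 : ℝ) ^ (Real.logb 2 (1 + 1 / √2) * n)⌋₊)) atTop (𝓝 0) := by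
  refine tendsto_const_nhds.congr' ?_
  filter_upwards [eventually_ge_atTop 2] with n hn
  symm
  have hs : (3 / 2 : ℝ) ≤ 1 + 1 / √2 := by
    have := one_div_le_one_div_of_le (by positivity) sqrt_two_bounds.2.le
    norm_num at this ⊢
    linarith
  rw [two_rpow_logb_mul]
  apply conversionError_maxEntangled_eq_zero
  · rw [Nat.le_floor_iff (by positivity)]
    calc ((2 : ℕ) : ℝ) ≤ (3 / 2) ^ 2 := by norm_num
      _ ≤ (1 + 1 / √2) ^ 2 := pow_le_pow_left₀ (by norm_num) hs 2
      _ ≤ (1 + 1 / √2) ^ n := pow_le_pow_right₀ (by linarith) hn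
  · calc (⌊(1 + 1 / √2) ^ n⌋₊ : ℝ) * (2 - √2) ^ n ≤ (1 + 1 / √2) ^ n * (2 - √2) ^ n :=
          mul_le_mul_of_nonneg_right (Nat.floor_le (by positivity))
            (pow_nonneg two_sub_sqrt_two_pos.le n)
      _ = 1 := by rw [← mul_pow, mul_comm, two_sub_sqrt_two_mul, one_pow]

/-- At a larger rate the fidelity with the target, at most `(1 + 1/√2)^n / d`, tends to zero. -/
theorem le_logb_of_distillable_rate {r : ℝ} (hr0 : 0 ≤ r)
    (hr : Tendsto (fun n : ℕ => conversionError (tensorPower rhoV n)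
      (maxEntangled ⌊(2 : ℝ) ^ (r * n)⌋₊)) atTop (𝓝 0)) :
    r ≤ Real.logb 2 (1 + 1 / √2) := by
  by_contra! hlt
  have h1 := hr.eventually_lt_const (ENNReal.ofReal_pos.2 (by norm_num : (0 : ℝ) < 1 / 2))
  obtain ⟨n, hn1, hn2⟩ := (h1.and (eventually_lt_two_rpow (sub_pos.2 hlt) 3)).exists
  obtain ⟨Λ, hΛ, hnorm⟩ := exists_of_conversionError_lt (by norm_num) hn1
  set d := ⌊(2 : ℝ) ^ (r * n)⌋₊ with hd
  have hge1 : (1 : ℝ) ≤ 2 ^ (r * n) := Real.one_le_rpow (by norm_num) (by positivity)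
  have hdpos : 0 < d := Nat.floor_pos.2 hge1
  have hdlt : (2 : ℝ) ^ (r * n) < d + 1 := Nat.lt_floor_add_one _
  have h2 := re_trace_mul_sub_traceNorm_le (maxEntangled_posSemidef (d := d))
    one_sub_maxEntangled_posSemidef (hΛ.posSemidef (tensorPower_rhoV_posSemidef (n := n))).isHermitian
    maxEntangled_isHermitian
  rw [maxEntangled_mul_self, trace_maxEntangled hdpos.ne', Complex.one_re] at h2
  have h3 := re_trace_maxEntangled_mul_le hΛ (tensorPower_rhoV_posSemidef (n := n)).isHermitian
  have h4 := traceNorm_partialTranspose_rhoV (n := n) zero_le_one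
  rw [Complex.ofReal_one, one_smul, one_mul] at h4
  have hdR : (0 : ℝ) < d := by exact_mod_cast hdpos
  rw [h4, one_div, inv_mul_eq_div] at h3
  have h5 : (1 / 2 : ℝ) < (1 + 1 / √2) ^ n / d := by linarith
  rw [lt_div_iff₀ hdR] at h5
  have h6 : (2 : ℝ) ^ (r * n) = 2 ^ ((r - Real.logb 2 (1 + 1 / √2)) * n) * (1 + 1 / √2) ^ n := by
    rw [← two_rpow_logb_mul, ← Real.rpow_add (by norm_num)]
    congr 1; ring
  have h7 : (1 : ℝ) ≤ (1 + 1 / √2) ^ n := one_le_pow₀ (by simp)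
  nlinarith

theorem logb_nonneg : 0 ≤ Real.logb 2 (1 + 1 / √2) :=
  Real.logb_nonneg (by norm_num) (by simp)

theorem logb_lt_one : Real.logb 2 (1 + 1 / √2) < 1 := by
  rw [Real.logb_lt_iff_lt_rpow (by norm_num) one_add_inv_sqrt_two_pos, Real.rpow_one]
  have := (div_lt_one (by positivity : (0 : ℝ) < √2)).2 sqrt_two_bounds.1
  linarith

theorem distillablePPT_rhoV :
    distillablePPT rhoV = ((Real.logb 2 (1 + 1 / √2) : ℝ) : EReal) := by
  apply le_antisymm
  · refine sSup_le ?_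
    rintro _ ⟨r, ⟨hr0, hr⟩, rfl⟩
    exact EReal.coe_le_coe_iff.2 (le_logb_of_distillable_rate hr0 hr)
  · exact le_sSup ⟨_, ⟨logb_nonneg, logb_mem_distillable_rates⟩, rfl⟩

end Distillation

/-! ### Entanglement cost -/

section Cost

/-- The local isometry `ℂ² → ℂ³` with `|0⟩ ↦ |0⟩`, `|1⟩ ↦ |k + 1⟩`. -/
def aliceZ (k : Fin 2) : Matrix (Fin 3) (Fin 2) ℤ :=
  Matrix.of fun x s => if s = 0 then (if x = 0 then 1 else 0) else (if x = k.succ then 1 else 0)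

/-- The local isometry `ℂ² → ℂ³` with `|0⟩ ↦ |k + 1⟩`, `|1⟩ ↦ -|0⟩`. -/
def bobZ (k : Fin 2) : Matrix (Fin 3) (Fin 2) ℤ :=
  Matrix.of fun x s => if s = 0 then (if x = k.succ then 1 else 0) else (if x = 0 then -1 else 0)

theorem aliceZ_isometry (k : Fin 2) : (aliceZ k).transpose * aliceZ k = 1 := by
  revert k; decide +kernel

theorem bobZ_isometry (k : Fin 2) : (bobZ k).transpose * bobZ k = 1 := by
  revert k; decide +kernel

theorem aliceZ_mul_bobZ (k : Fin 2) (x : Fin 3 × Fin 3) :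
    (aliceZ k * (bobZ k).transpose) x.1 x.2 = antisymZ k x := by
  revert k x; decide +kernel

/-- The tensor product of a family of rectangular matrices, with columns relabelled along `e`. -/
def tensorMatrix {n : ℕ} {a b ι : Type*} (e : ι ≃ (Fin n → b)) (M : Fin n → Matrix a b ℂ) :
    Matrix (Fin n → a) ι ℂ :=
  Matrix.of fun x s => ∏ i, M i (x i) (e s i)

theorem tensorMatrix_isometry {n : ℕ} {a b ι : Type*} [Fintype a] [DecidableEq b] [DecidableEq ι]
    (e : ι ≃ (Fin n → b)) {M : Fin n → Matrix a b ℂ} (hM : ∀ i, (M i).conjTranspose * M i = 1) :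
    (tensorMatrix e M).conjTranspose * tensorMatrix e M = 1 := by
  ext s t
  simp only [tensorMatrix, Matrix.mul_apply, Matrix.conjTranspose_apply, Matrix.of_apply,
    star_prod, ← Finset.prod_mul_distrib]
  rw [← Fintype.prod_sum fun i z => star (M i z (e s i)) * M i z (e t i)]
  have h : ∀ i, ∑ z, star (M i z (e s i)) * M i z (e t i) = if e s i = e t i then 1 else 0 := by
    intro i
    rw [← Matrix.one_apply, ← hM i, Matrix.mul_apply]
    rfl
  simp only [h, Matrix.one_apply]
  rw [Finset.prod_ite_zero]
  simp [← funext_iff]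

theorem tensorMatrix_mul_transpose {n : ℕ} {a b ι : Type*} [Fintype b] [Fintype ι]
    (e : ι ≃ (Fin n → b)) (M N : Fin n → Matrix a b ℂ) (x y : Fin n → a) :
    (tensorMatrix e M * (tensorMatrix e N).transpose) x y =
      ∏ i, (M i * (N i).transpose) (x i) (y i) := by
  simp only [tensorMatrix, Matrix.mul_apply, Matrix.transpose_apply, Matrix.of_apply,
    ← Finset.prod_mul_distrib]
  rw [Fintype.prod_sum fun i z => M i (x i) z * N i (y i) z]
  exact Fintype.sum_equiv e _ _ fun s => rfl

/-- `Φ(2)^{⊗ n}` is converted exactly into `ρ^{⊗ n}` by random local isometries: on each copy the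
pair `(aliceZ k, bobZ k)` maps `Φ(2)` to the antisymmetric state on levels `0` and `k + 1`. -/
theorem conversionError_rhoV_eq_zero {n d : ℕ} (hd : d = 2 ^ n) :
    conversionError (maxEntangled d) (tensorPower rhoV n) = 0 := by
  have e : Fin d ≃ (Fin n → Fin 2) := (finCongr hd).trans finFunctionFinEquiv.symm
  let A : (Fin n → Fin 2) → Matrix (Fin n → Fin 3) (Fin d) ℂ :=
    fun f => tensorMatrix e fun i => ofInt (aliceZ (f i))
  let B : (Fin n → Fin 2) → Matrix (Fin n → Fin 3) (Fin d) ℂ :=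
    fun f => tensorMatrix e fun i => ofInt (bobZ (f i))
  refine conversionError_eq_zero (localMixture_isPPTOperation (A := A) (B := B) (fun f => ?_)
    fun f => ?_) ?_
  · refine tensorMatrix_isometry e fun i => ?_
    rw [ofInt_conjTranspose, ofInt_mul, aliceZ_isometry, ofInt_one]
  · refine tensorMatrix_isometry e fun i => ?_
    rw [ofInt_conjTranspose, ofInt_mul, bobZ_isometry, ofInt_one]
  · have hAB : ∀ (f : Fin n → Fin 2) (x : (Fin n → Fin 3) × (Fin n → Fin 3)),
        (A f * (B f).transpose) x.1 x.2 = ∏ i, (antisymZ (f i) (x.1 i, x.2 i) : ℂ) := by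
      intro f x
      rw [tensorMatrix_mul_transpose]
      refine Finset.prod_congr rfl fun i _ => ?_
      have : (ofInt (bobZ (f i))).transpose = ofInt (bobZ (f i)).transpose := rfl
      rw [this, ofInt_mul, ofInt_apply, aliceZ_mul_bobZ (f i) (x.1 i, x.2 i)]
    ext x y
    rw [tensorPower_apply]
    simp only [rhoV_apply]
    rw [Finset.prod_mul_distrib, Fintype.prod_sum fun i k =>
      (antisymZ k (x.1 i, x.2 i) : ℂ) * antisymZ k (y.1 i, y.2 i)]
    simp only [localMixture, LinearMap.smul_apply, LinearMap.sum_apply, Matrix.smul_apply,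
      Matrix.sum_apply, localConj_maxEntangled_apply, hAB, smul_eq_mul, ← Finset.mul_sum]
    rw [← mul_assoc]
    congr 1
    · simp [hd, ← mul_pow, ← mul_inv]
      norm_num
    · refine Finset.sum_congr rfl fun f _ => ?_
      rw [star_prod, ← Finset.prod_mul_distrib]
      simp

theorem one_mem_cost_rates :
    Tendsto (fun n : ℕ => conversionError (maxEntangled ⌊(2 : ℝ) ^ ((1 : ℝ) * n)⌋₊)
      (tensorPower rhoV n)) atTop (𝓝 0) := by
  refine tendsto_const_nhds.congr fun n => (conversionError_rhoV_eq_zero ?_).symm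
  rw [one_mul, Real.rpow_natCast]
  exact_mod_cast Nat.floor_natCast (R := ℝ) (2 ^ n)

/-- At a smaller rate the overlap of the output with the support projection of `ρ^{⊗ n}`, at most
`2^{-n} d`, tends to zero. -/
theorem one_le_of_cost_rate {r : ℝ}
    (hr : Tendsto (fun n : ℕ => conversionError (maxEntangled ⌊(2 : ℝ) ^ (r * n)⌋₊)
      (tensorPower rhoV n)) atTop (𝓝 0)) : 1 ≤ r := by
  by_contra! hlt
  have h1 := hr.eventually_lt_const (ENNReal.ofReal_pos.2 (by norm_num : (0 : ℝ) < 1 / 2))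
  obtain ⟨n, hn1, hn2⟩ := (h1.and (eventually_lt_two_rpow (sub_pos.2 hlt) 2)).exists
  obtain ⟨Λ, hΛ, hnorm⟩ := exists_of_conversionError_lt (by norm_num) hn1
  set d := ⌊(2 : ℝ) ^ (r * n)⌋₊ with hd
  set P := tensorPower ((2 : ℂ) • rhoV) n with hP
  have hPpsd : P.PosSemidef := tensorPower_posSemidef two_smul_rhoV_posSemidef
  have hPP : P * P = P := by
    rw [hP, ← tensorPower_mul, Matrix.smul_mul, Matrix.mul_smul, rhoV_mul_self]
    simp only [smul_smul]
    norm_num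
  have hPρ : P * tensorPower rhoV n = tensorPower rhoV n := by
    rw [hP, ← tensorPower_mul, Matrix.smul_mul, rhoV_mul_self]
    simp only [smul_smul]
    norm_num
  have h2 := re_trace_mul_sub_traceNorm_le hPpsd
    (one_sub_posSemidef_of_cube hPpsd.isHermitian (by rw [hPP, hPP]))
    (hΛ.posSemidef (maxEntangled_posSemidef (d := d))).isHermitian
    (tensorPower_rhoV_posSemidef (n := n)).isHermitian
  rw [hPρ, trace_tensorPower_rhoV, Complex.one_re] at h2
  have h3 := re_trace_mul_apply_maxEntangled_le hΛ hPpsd fun ω hω => re_trace_support_mul_le hω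
  have h4 : (d : ℝ) ≤ 2 ^ (r * n) := Nat.floor_le (by positivity)
  have h5 : (2 : ℝ) ^ ((1 - r) * n) * 2 ^ (r * n) = 2 ^ n := by
    rw [← Real.rpow_add (by norm_num), ← Real.rpow_natCast]
    congr 1; ring
  have h6 : (1 / 2 : ℝ) ^ n * 2 ^ n = 1 := by rw [← mul_pow]; norm_num
  have h7 : (1 / 2 : ℝ) < (1 / 2) ^ n * d := by linarith
  have h8 : (1 / 2 : ℝ) ^ n * d * 2 ≤ (1 / 2) ^ n * 2 ^ n := by
    rw [mul_assoc]
    refine mul_le_mul_of_nonneg_left ?_ (by positivity)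
    have : (0 : ℝ) < 2 ^ (r * n) := by positivity
    nlinarith
  linarith

theorem costPPT_rhoV : costPPT rhoV = 1 := by
  apply le_antisymm
  · exact sInf_le ⟨1, ⟨zero_le_one, one_mem_cost_rates⟩, rfl⟩
  · refine le_sInf ?_
    rintro _ ⟨r, ⟨-, hr⟩, rfl⟩
    exact EReal.coe_le_coe_iff.2 (one_le_of_cost_rate hr)

end Cost

end PPTEnt

theorem theorem1 :
    ∃ ER R : EReal,
      PPTEnt.IsRegularizedREE PPTEnt.rhoV ER ∧
      PPTEnt.IsRegularizedRains PPTEnt.rhoV R ∧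
      PPTEnt.costPPT PPTEnt.rhoV = ER ∧
      ER > R ∧
      R = PPTEnt.distillablePPT PPTEnt.rhoV ∧
      ER = 1 ∧
      R = ((Real.logb 2 (1 + 1 / √2) : ℝ) : EReal) ∧
      Real.logb 2 (1 + 1 / √2) < 1 := by
  refine ⟨1, ((Real.logb 2 (1 + 1 / √2) : ℝ) : EReal), ?_, ?_, PPTEnt.costPPT_rhoV, ?_,
    PPTEnt.distillablePPT_rhoV.symm, rfl, rfl, PPTEnt.logb_lt_one⟩
  · refine PPTEnt.tendsto_regularization (L := 1) fun n => ?_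
    rw [PPTEnt.reePPT_tensorPower_rhoV, mul_one]
  · exact PPTEnt.tendsto_regularization PPTEnt.rainsBound_tensorPower_rhoV
  · exact_mod_cast PPTEnt.logb_lt_one
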